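/- Let $A\in\mathbb R^{n\times d}$ with $d\ge 2$, let $\lambda_1\ge\lambda_2\ge\dots\ge\lambda_d\ge 0$ be the eigenvalues of $A^\top A$, and assume $\mathrm{gap}=\frac{\lambda_1-\lambda_2}{\lambda_1}>0$. For a symmetric $d\times d$ matrix $M$ and a matrix $Y\in\mathbb R^{d\times 2}$ let $\mathrm{eigEstimate}_M(Y)=(\tilde v_1^\top M\tilde v_1,\ \tilde v_2^\top M\tilde v_2)$, where $\tilde v_1,\tilde v_2$ are the top two left singular vectors of $Y$ (orthonormal eigenvectors for the two largest eigenvalues of $YY^\top$). Given $\alpha>100$, a power $t\in\mathbb N$ and start blocks $W_0,W_1,\dots\in\mathbb R^{d\times 2}$, consider the following algorithm. * Initialize $(\tilde\lambda^{(0)}_1,\tilde\lambda^{(0)}_2)=\mathrm{eigEstimate}_{A^\top A}\big((A^\top A)^tW_0\big)$, $\bar\lambda^{(0)}=(1+\tfrac12)\tilde\lambda^{(0)}_1$ and $i=0$. * If $\bar\lambda^{(i)}-\tilde\lambda^{(i)}_1<\frac1{10}\big(\bar\lambda^{(i)}-\tilde\lambda^{(i)}_2\big)$, exit with $T=i$ and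 output $\bar\lambda^{(T)}$. * Otherwise increase $i$ by one, put $M_i=(\bar\lambda^{(i-1)}I-A^\top A)^{-1}$, compute $(\hat\lambda^{(i)}_1,\hat\lambda^{(i)}_2)=\mathrm{eigEstimate}_{M_i}(M_i^tW_i)$, set $\tilde\lambda^{(i)}_k=\bar\lambda^{(i-1)}-1/\hat\lambda^{(i)}_k$ for $k=1,2$ and $\bar\lambda^{(i)}=\frac12\big(\tilde\lambda^{(i)}_1+\bar\lambda^{(i-1)}\big)$, and go back to the exit test. Let $N=\lceil\log_2(10/\mathrm{gap})\rceil+1$. Call number $0$ of $\mathrm{eigEstimate}$ (the initialization) is accurate if $|\tilde\lambda^{(0)}_k-\lambda_k|\le\frac1\alpha\lambda_k$ for $k=1,2$; call number $i\ge1$ is accurate if $|\hat\lambda^{(i)}_k-\lambda_k(M_i)|\le\frac1\alpha\lambda_k(M_i)$ for $k=1,2$, where $\lambda_1(M_i)\ge\lambda_2(M_i)$ are the two largest eigenvalues of $M_i$. **Theorem.** For every $q\in\mathbb N$ there is a constant $c>0$, depending on nothing but $q$, such that for all $A$ and $\alpha$ as above: 1. For every $t\in\mathbb N$ and all $W_0,W_1,\dots$: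 if every call with number at most $N$ that the algorithm makes before it exits is accurate, then the algorithm exits after $T$ iterations with $$T\le\Big\lceil\log_2\frac{10}{\mathrm{gap}}\Big\rceil+1\qquad\text{and}\qquad\Big(1+\frac{\mathrm{gap}}{120}\Big)\lambda_1\le\bar\lambda^{(T)}\le\Big(1+\frac{\mathrm{gap}}8\Big)\lambda_1 .$$ 2. If $t\ge c\,\alpha\log d$ and all entries of $W_0,W_1,\dots$ are independent $\mathcal N(0,1)$ random variables, then with probability at least $1-(N+1)d^{-q}$ every call with number at most $N$ that the algorithm makes before it exits is accurate and, consequently, the algorithm exits after $T$ iterations with the bounds of part 1. -/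

import Mathlib

noncomputable section

namespace ShiftEstimate

open Matrix

/-- The position in `Fin d` of the `k`-th largest eigenvalue, `k = 0, 1`. -/
def topIdx {d : ℕ} (hd : 2 ≤ d) (k : Fin 2) : Fin d := Fin.castLE hd k

/-- The `k`-th largest eigenvalue (with multiplicity, counted from `k = 0`) of a real symmetric
matrix. -/
def sortedEigenvalue {d : ℕ} {S : Matrix (Fin d) (Fin d) ℝ} (hS : S.IsHermitian) (k : Fin d) : ℝ :=
  hS.eigenvalues₀ (Fin.cast (Fintype.card_fin d).symm k)

/-- A unit eigenvector belonging to the `k`-th largest eigenvalue; for distinct `k` these vectors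
are orthonormal (they form Mathlib's eigenbasis, listed by decreasing eigenvalue). -/
def sortedEigenvector {d : ℕ} {S : Matrix (Fin d) (Fin d) ℝ} (hS : S.IsHermitian) (k : Fin d) :
    Fin d → ℝ :=
  (hS.eigenvectorBasis
    (Fintype.equivOfCardEq (Fintype.card_fin _) (Fin.cast (Fintype.card_fin d).symm k))).ofLp

theorem mulVec_sortedEigenvector {d : ℕ} {S : Matrix (Fin d) (Fin d) ℝ} (hS : S.IsHermitian)
    (k : Fin d) :
    S *ᵥ sortedEigenvector hS k = sortedEigenvalue hS k • sortedEigenvector hS k := by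
  unfold sortedEigenvector sortedEigenvalue
  rw [hS.mulVec_eigenvectorBasis]
  unfold Matrix.IsHermitian.eigenvalues
  rw [Equiv.symm_apply_apply]

theorem isHermitian_mul_transpose {d k : ℕ} (Y : Matrix (Fin d) (Fin k) ℝ) :
    (Y * Yᵀ).IsHermitian := by
  simpa using Matrix.isHermitian_mul_conjTranspose_self Y

theorem isHermitian_gram {n d : ℕ} (A : Matrix (Fin n) (Fin d) ℝ) : (Aᵀ * A).IsHermitian := by
  simpa using Matrix.isHermitian_conjTranspose_mul_self A

/-- The shifted-and-inverted matrix `(lam I - Aᵀ A)⁻¹`. -/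
def shiftInv {n d : ℕ} (A : Matrix (Fin n) (Fin d) ℝ) (lam : ℝ) : Matrix (Fin d) (Fin d) ℝ :=
  (lam • (1 : Matrix (Fin d) (Fin d) ℝ) - Aᵀ * A)⁻¹

theorem isHermitian_shiftInv {n d : ℕ} (A : Matrix (Fin n) (Fin d) ℝ) (lam : ℝ) :
    (shiftInv A lam).IsHermitian := by
  unfold shiftInv
  refine Matrix.IsHermitian.inv (Matrix.IsHermitian.sub ?_ (isHermitian_gram A))
  simp [Matrix.IsHermitian]

/-- The top two eigenvalues of `Aᵀ A`: `lam1 = gramEig hd A 0` and `lam2 = gramEig hd A 1`. -/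
def gramEig {n d : ℕ} (hd : 2 ≤ d) (A : Matrix (Fin n) (Fin d) ℝ) (k : Fin 2) : ℝ :=
  sortedEigenvalue (isHermitian_gram A) (topIdx hd k)

/-- The relative eigenvalue gap `(lam1 - lam2) / lam1` of `Aᵀ A`. -/
def gap {n d : ℕ} (hd : 2 ≤ d) (A : Matrix (Fin n) (Fin d) ℝ) : ℝ :=
  (gramEig hd A 0 - gramEig hd A 1) / gramEig hd A 0

/-- The eigenvalue estimates of the power method: the Rayleigh quotients `vₖᵀ M vₖ`, where `vₖ` is
the `k`-th left singular vector of `Y` (the `k`-th unit eigenvector of `Y Yᵀ`). It is used with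
`Y = M ^ t * W`. -/
def eigEstimate {d : ℕ} (hd : 2 ≤ d) (M : Matrix (Fin d) (Fin d) ℝ) (Y : Matrix (Fin d) (Fin 2) ℝ)
    (k : Fin 2) : ℝ :=
  let v := sortedEigenvector (isHermitian_mul_transpose Y) (topIdx hd k)
  v ⬝ᵥ (M *ᵥ v)

/-- The values held by the algorithm after an iteration: the estimates `lamTilde 0`, `lamTilde 1`
of the two top eigenvalues, and the shift `lamBar`. -/
structure Iterate where
  lamTilde : Fin 2 → ℝ
  lamBar : ℝ

/-- The estimates of the top two eigenvalues of the shifted-and-inverted matrix with shift `lam`. -/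
def lamHat {n d : ℕ} (hd : 2 ≤ d) (A : Matrix (Fin n) (Fin d) ℝ) (t : ℕ) (lam : ℝ)
    (W : Matrix (Fin d) (Fin 2) ℝ) (k : Fin 2) : ℝ :=
  eigEstimate hd (shiftInv A lam) (shiftInv A lam ^ t * W) k

/-- The initialization of the algorithm, from the start block `W`. -/
def initIterate {n d : ℕ} (hd : 2 ≤ d) (A : Matrix (Fin n) (Fin d) ℝ) (t : ℕ)
    (W : Matrix (Fin d) (Fin 2) ℝ) : Iterate where
  lamTilde := eigEstimate hd (Aᵀ * A) ((Aᵀ * A) ^ t * W)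
  lamBar := (1 + 1 / 2) * eigEstimate hd (Aᵀ * A) ((Aᵀ * A) ^ t * W) 0

/-- The body of the loop, with the fresh start block `W`. -/
def stepIterate {n d : ℕ} (hd : 2 ≤ d) (A : Matrix (Fin n) (Fin d) ℝ) (t : ℕ)
    (W : Matrix (Fin d) (Fin 2) ℝ) (s : Iterate) : Iterate where
  lamTilde := fun k => s.lamBar - 1 / lamHat hd A t s.lamBar W k
  lamBar := (1 / 2) * ((s.lamBar - 1 / lamHat hd A t s.lamBar W 0) + s.lamBar)

/-- The `i`-th iterate of the algorithm (disregarding the exit test); `W i` is the block of two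
start vectors drawn for the `i`-th call of the power method. -/
def iterate {n d : ℕ} (hd : 2 ≤ d) (A : Matrix (Fin n) (Fin d) ℝ) (t : ℕ)
    (W : ℕ → Matrix (Fin d) (Fin 2) ℝ) : ℕ → Iterate
  | 0 => initIterate hd A t (W 0)
  | i + 1 => stepIterate hd A t (W (i + 1)) (iterate hd A t W i)

/-- The exit test of the loop. -/
def Iterate.ExitTest (s : Iterate) : Prop :=
  s.lamBar - s.lamTilde 0 < (1 / 10) * (s.lamBar - s.lamTilde 1)

/-- The algorithm exits after exactly `T` iterations of its loop. -/
def ExitsAfter {n d : ℕ} (hd : 2 ≤ d) (A : Matrix (Fin n) (Fin d) ℝ) (t : ℕ)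
    (W : ℕ → Matrix (Fin d) (Fin 2) ℝ) (T : ℕ) : Prop :=
  (iterate hd A t W T).ExitTest ∧ ∀ i < T, ¬ (iterate hd A t W i).ExitTest

/-- The bound `⌈log₂ (10 / gap)⌉ + 1` on the number of iterations. -/
def maxIter {n d : ℕ} (hd : 2 ≤ d) (A : Matrix (Fin n) (Fin d) ℝ) : ℕ :=
  ⌈Real.logb 2 (10 / gap hd A)⌉₊ + 1

/-- The desired outcome: the algorithm exits, after at most `maxIter` iterations, and the final
shift is `(1 + Θ(gap)) * lam1` with the stated constants. -/
def Succeeds {n d : ℕ} (hd : 2 ≤ d) (A : Matrix (Fin n) (Fin d) ℝ) (t : ℕ)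
    (W : ℕ → Matrix (Fin d) (Fin 2) ℝ) : Prop :=
  ∃ T : ℕ, ExitsAfter hd A t W T ∧ T ≤ maxIter hd A ∧
    (1 + gap hd A / 120) * gramEig hd A 0 ≤ (iterate hd A t W T).lamBar ∧
    (iterate hd A t W T).lamBar ≤ (1 + gap hd A / 8) * gramEig hd A 0

/-- The `i`-th call of the power method estimates both eigenvalues of the matrix it is applied to
within relative error `1 / α`. -/
def CallAccurate {n d : ℕ} (hd : 2 ≤ d) (A : Matrix (Fin n) (Fin d) ℝ) (α : ℝ) (t : ℕ)
    (W : ℕ → Matrix (Fin d) (Fin 2) ℝ) : ℕ → Prop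
  | 0 => ∀ k : Fin 2, |(iterate hd A t W 0).lamTilde k - gramEig hd A k| ≤ gramEig hd A k / α
  | i + 1 => ∀ k : Fin 2,
      |lamHat hd A t (iterate hd A t W i).lamBar (W (i + 1)) k
          - sortedEigenvalue (isHermitian_shiftInv A (iterate hd A t W i).lamBar) (topIdx hd k)|
        ≤ sortedEigenvalue (isHermitian_shiftInv A (iterate hd A t W i).lamBar) (topIdx hd k) / α

/-- Every call that the algorithm makes before it exits, among those with number at most
`maxIter`, is accurate. -/
def CallsAccurate {n d : ℕ} (hd : 2 ≤ d) (A : Matrix (Fin n) (Fin d) ℝ) (α : ℝ) (t : ℕ)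
    (W : ℕ → Matrix (Fin d) (Fin 2) ℝ) : Prop :=
  ∀ i ≤ maxIter hd A, (∀ j < i, ¬ (iterate hd A t W j).ExitTest) → CallAccurate hd A α t W i

end ShiftEstimate

end

namespace ShiftEstimate

section

open Matrix MeasureTheory ProbabilityTheory

/-! Deterministic half. Let e_i be the excess of the i-th shift over lam1. A Rayleigh quotient never
exceeds the top eigenvalue, so accurate calls keep e_i positive and multiply it by a factor in
[0.49, 1/2] at each step (`lamBar_succ`). The exit test compares two inverted estimates and decides,
up to constants, whether lam1 - lam2 is at least about 4.5 times the previous excess. Failure at the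
last allowed step contradicts the geometric decay of e_i. At the exit, success of the test and its
failure one step earlier pin e_T from both sides (`CallsAccurate.succeeds`).

Probabilistic half. All matrices being powered share the eigenbasis V of AᵀA. Whether a start block
W is good (`IsGoodBlock`) depends on V * W alone and not on the shift, so a union bound over the
blocks suffices although the shifts depend on earlier blocks. For a good block, the coordinates of
the singular vectors of M ^ t * W are controlled by powers of the eigenvalues, which makes both
Rayleigh quotients accurate without any gap assumption (`IsSortedDiag.abs_eigEstimate_sub_le`). A
Gaussian block is likely good: its entries are rarely large, and the top 2×2 minor of V * W is
bilinear in the two columns of W, so two one-dimensional anti-concentration bounds keep it away from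
zero (`exists_measurableSet_not_isGoodBlock`). -/

/-- `S = Vᵀ diag(μ) V` with `V` orthogonal and `μ` decreasing. -/
structure IsSortedDiag {d : ℕ} (V S : Matrix (Fin d) (Fin d) ℝ) (μ : Fin d → ℝ) : Prop where
  orth : V * Vᵀ = 1
  anti : Antitone μ
  eq : S = Vᵀ * diagonal μ * V

/-! ### Sorted orthogonal diagonalizations. -/

theorem sortedEigenvector_dotProduct {d : ℕ} {S : Matrix (Fin d) (Fin d) ℝ} (hS : S.IsHermitian)
    (i j : Fin d) :
    sortedEigenvector hS i ⬝ᵥ sortedEigenvector hS j = if i = j then 1 else 0 := by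
  have h := orthonormal_iff_ite.1 hS.eigenvectorBasis.orthonormal
    (Fintype.equivOfCardEq (Fintype.card_fin _) (Fin.cast (Fintype.card_fin d).symm j))
    (Fintype.equivOfCardEq (Fintype.card_fin _) (Fin.cast (Fintype.card_fin d).symm i))
  rw [EuclideanSpace.inner_eq_star_dotProduct] at h
  simp only [star_trivial, EmbeddingLike.apply_eq_iff_eq, Fin.cast_inj] at h
  simp only [sortedEigenvector, h, eq_comm]

theorem isSortedDiag_of_isHermitian {d : ℕ} {S : Matrix (Fin d) (Fin d) ℝ} (hS : S.IsHermitian) :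
    IsSortedDiag (Matrix.of (sortedEigenvector hS)) S (sortedEigenvalue hS) := by
  set V : Matrix (Fin d) (Fin d) ℝ := Matrix.of (sortedEigenvector hS) with hV
  have horth : V * Vᵀ = 1 := by
    ext i j
    rw [Matrix.mul_apply', one_apply, ← sortedEigenvector_dotProduct hS]
    rfl
  refine ⟨horth, fun i j hij => hS.eigenvalues₀_antitone ?_, ?_⟩
  · simpa using hij
  · have h1 : S * Vᵀ = Vᵀ * diagonal (sortedEigenvalue hS) := by
      ext i j
      have := congrFun (mulVec_sortedEigenvector hS j) i
      rw [mul_diagonal, Matrix.mul_apply', mul_comm]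
      exact this
    rw [← h1, mul_assoc, mul_eq_one_comm.1 horth, mul_one]

namespace IsSortedDiag

variable {d : ℕ} {V S : Matrix (Fin d) (Fin d) ℝ} {μ : Fin d → ℝ}

theorem orth' (h : IsSortedDiag V S μ) : Vᵀ * V = 1 := mul_eq_one_comm.1 h.orth

/-- Both sides list the roots of the characteristic polynomial in decreasing order. -/
theorem sortedEigenvalue_eq (h : IsSortedDiag V S μ) (hS : S.IsHermitian) (k : Fin d) :
    sortedEigenvalue hS k = μ k := by
  have hc : S.charpoly = ∏ i, (Polynomial.X - Polynomial.C (μ i)) := by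
    rw [h.eq, charpoly_mul_comm, ← mul_assoc, h.orth, one_mul, charpoly_diagonal]
  have hr : S.charpoly.roots = Multiset.map μ Finset.univ.val := by
    rw [hc, Polynomial.roots_prod]
    · simp
    · simp [Finset.prod_ne_zero_iff, Polynomial.X_sub_C_ne_zero]
  have h1 := hS.sort_roots_charpoly_eq_eigenvalues₀
  have h2 : (S.charpoly.roots.map RCLike.re).sort (· ≥ ·) = List.ofFn μ := by
    rw [hr]
    simp only [Fin.univ_val_map, Multiset.map_coe, List.map_ofFn, Multiset.coe_sort]
    apply List.mergeSort_of_pairwise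
    simp_rw [decide_eq_true_eq, ← List.sortedGE_iff_pairwise]
    exact h.anti.sortedGE_ofFn
  rw [h2, List.ofFn_congr (Fintype.card_fin d).symm μ, List.ofFn_inj] at h1
  rw [sortedEigenvalue, ← h1]
  rfl

theorem sum_mulVec_sq (h : IsSortedDiag V S μ) (x : Fin d → ℝ) :
    ∑ j, (V *ᵥ x) j ^ 2 = x ⬝ᵥ x := by
  have : ∑ j, (V *ᵥ x) j ^ 2 = (V *ᵥ x) ⬝ᵥ (V *ᵥ x) := by simp [dotProduct, sq]
  rw [this, dotProduct_mulVec, vecMul_mulVec, h.orth', vecMul_one]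

theorem sum_mulVec_mul (h : IsSortedDiag V S μ) (x y : Fin d → ℝ) :
    ∑ j, (V *ᵥ x) j * (V *ᵥ y) j = x ⬝ᵥ y := by
  change (V *ᵥ x) ⬝ᵥ (V *ᵥ y) = _
  rw [dotProduct_mulVec, vecMul_mulVec, h.orth', vecMul_one]

theorem dotProduct_mulVec_self (h : IsSortedDiag V S μ) (x : Fin d → ℝ) :
    x ⬝ᵥ (S *ᵥ x) = ∑ j, μ j * (V *ᵥ x) j ^ 2 := by
  have : ∑ j, μ j * (V *ᵥ x) j ^ 2 = (V *ᵥ x) ⬝ᵥ (diagonal μ *ᵥ (V *ᵥ x)) := by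
    simp only [dotProduct, mulVec_diagonal]
    exact Finset.sum_congr rfl fun j _ => by ring
  rw [this, h.eq, ← mulVec_mulVec, ← mulVec_mulVec, dotProduct_mulVec, vecMul_transpose]

theorem pow (h : IsSortedDiag V S μ) (t : ℕ) : S ^ t = Vᵀ * diagonal (fun j => μ j ^ t) * V := by
  induction t with
  | zero => simp [h.orth']
  | succ t ih =>
    have : diagonal (fun j => μ j ^ (t + 1)) = diagonal (fun j => μ j ^ t) * diagonal μ := by
      rw [diagonal_mul_diagonal]; simp [pow_succ]
    rw [pow_succ, ih]
    nth_rw 1 [h.eq]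
    rw [this]
    simp only [mul_assoc]
    rw [← mul_assoc V Vᵀ, h.orth, one_mul]

theorem dotProduct_row (h : IsSortedDiag V S μ) (i j : Fin d) :
    V i ⬝ᵥ V j = if i = j then 1 else 0 := by
  have := congrFun (congrFun h.orth i) j
  rw [Matrix.mul_apply', one_apply] at this
  exact this

/-- The same V diagonalizes every shifted inverse, and for shifts above the spectrum the order of
the eigenvalues is kept. This makes one goodness condition serve all calls. -/
theorem shiftInv {n : ℕ} {A : Matrix (Fin n) (Fin d) ℝ} (h : IsSortedDiag V (Aᵀ * A) μ) {s : ℝ}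
    (hs : ∀ j, μ j < s) : IsSortedDiag V (shiftInv A s) (fun j => 1 / (s - μ j)) := by
  refine ⟨h.orth, fun i j hij => ?_, ?_⟩
  · exact one_div_le_one_div_of_le (sub_pos.2 (hs i)) (by linarith [h.anti hij])
  · rw [ShiftEstimate.shiftInv]
    apply inv_eq_right_inv
    have h1 : s • (1 : Matrix (Fin d) (Fin d) ℝ) - Aᵀ * A
        = Vᵀ * diagonal (fun j => s - μ j) * V := by
      have : diagonal (fun j => s - μ j) = s • (1 : Matrix (Fin d) (Fin d) ℝ) - diagonal μ := by
        rw [← diagonal_one, ← diagonal_smul, diagonal_sub]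
        simp
      rw [this, h.eq, mul_sub, sub_mul, mul_smul_comm, smul_mul_assoc, mul_one, h.orth']
    rw [h1]
    simp only [mul_assoc]
    rw [← mul_assoc V Vᵀ, h.orth, one_mul, ← mul_assoc (diagonal _), diagonal_mul_diagonal]
    have : (fun i => (s - μ i) * (1 / (s - μ i))) = fun _ => 1 := by
      funext i
      exact mul_one_div_cancel (sub_pos.2 (hs i)).ne'
    rw [this, diagonal_one, one_mul, h.orth']

end IsSortedDiag

theorem gramEig_nonneg {n d : ℕ} (A : Matrix (Fin n) (Fin d) ℝ) (k : Fin d) :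
    0 ≤ sortedEigenvalue (isHermitian_gram A) k := by
  have h := mulVec_sortedEigenvector (isHermitian_gram A) k
  have h1 := sortedEigenvector_dotProduct (isHermitian_gram A) k k
  set v := sortedEigenvector (isHermitian_gram A) k
  have h2 : v ⬝ᵥ ((Aᵀ * A) *ᵥ v) = (A *ᵥ v) ⬝ᵥ (A *ᵥ v) := by
    rw [← mulVec_mulVec, dotProduct_mulVec, vecMul_transpose]
  rw [h, dotProduct_smul, h1] at h2
  have h3 : 0 ≤ (A *ᵥ v) ⬝ᵥ (A *ᵥ v) := Finset.sum_nonneg fun i _ => mul_self_nonneg _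
  simp at h2
  linarith

/-! ### Top indices and scalar estimates for spectral averages. -/

theorem topIdx_zero_ne_one {d : ℕ} (hd : 2 ≤ d) : topIdx hd 0 ≠ topIdx hd 1 := by
  simp [topIdx, Fin.ext_iff]

theorem topIdx_zero_le {d : ℕ} (hd : 2 ≤ d) (j : Fin d) : topIdx hd 0 ≤ j := by
  simp [topIdx, Fin.le_def]

theorem topIdx_one_le {d : ℕ} (hd : 2 ≤ d) {j : Fin d} (hj : j ≠ topIdx hd 0) :
    topIdx hd 1 ≤ j := by
  simp only [topIdx, Fin.le_def, ne_eq, Fin.ext_iff, Fin.val_castLE, Fin.val_zero, Fin.val_one]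
    at hj ⊢
  omega

/-- Each of the t terms of (1 - ρ) ∑ ρ ^ i = 1 - ρ ^ t is at least (1 - ρ) ρ ^ (t - 1). Bounding
this product by 1 / t spares a factor log α in the required power. -/
theorem one_sub_mul_pow_le {ρ : ℝ} (h0 : 0 ≤ ρ) (h1 : ρ ≤ 1) (t : ℕ) :
    (t : ℝ) * ((1 - ρ) * ρ ^ (t - 1)) ≤ 1 := by
  have h := mul_neg_geom_sum ρ t
  have h2 : (t : ℝ) * ρ ^ (t - 1) ≤ ∑ i ∈ Finset.range t, ρ ^ i := by
    have := Finset.card_nsmul_le_sum (Finset.range t) (fun i => ρ ^ i) (ρ ^ (t - 1)) fun i hi =>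
      pow_le_pow_of_le_one h0 h1 (by have := Finset.mem_range.1 hi; omega)
    simpa using this
  have h3 : 0 ≤ ρ ^ t := by positivity
  nlinarith [mul_le_mul_of_nonneg_left h2 (sub_nonneg.2 h1)]

/-- If `a` is a unit vector whose coordinates satisfy `ν ^ (2 t) a_j² ≤ μ_j ^ (2 t) R`, then the
coordinates with `μ_j` well below `ν` contribute little. -/
theorem sum_sub_mul_sq_le {d : ℕ} {μ a : Fin d → ℝ} {ν ε R : ℝ} {t : ℕ} (hμ : ∀ j, 0 ≤ μ j)
    (hν : 0 ≤ ν) (hε0 : 0 < ε) (hε1 : ε ≤ 1) (hR : 0 ≤ R) (ht : 1 ≤ t) (htε : 1 ≤ t * ε)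
    (hη : 4 * d * R * (1 - ε / 2) ^ t ≤ 1) (ha : ∑ j, a j ^ 2 = 1)
    (haj : ∀ j, ν ^ (2 * t) * a j ^ 2 ≤ μ j ^ (2 * t) * R) :
    ∑ j, (ν - μ j) * a j ^ 2 ≤ ε * ν := by
  rcases hν.eq_or_lt with rfl | hν
  · simp only [mul_zero]
    exact Finset.sum_nonpos fun j _ => by nlinarith [hμ j, sq_nonneg (a j)]
  set η : ℝ := (1 - ε / 2) ^ t with hη'
  have hη0 : 0 ≤ η := pow_nonneg (by linarith) _
  -- Coordinates with `μ j` at least (1 - ε/2)ν cost ε/2 times their mass; every other one costs at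
  -- most ε η R, and `hη` makes these add up to at most ε/4.
  have key : ∀ j, (ν - μ j) * a j ^ 2 ≤ ν * (ε / 2 * a j ^ 2 + ε * (η * R)) := by
    intro j
    have hb : 0 ≤ ν * (ε * (η * R)) := by positivity
    by_cases hj : (1 - ε / 2) * ν ≤ μ j
    · nlinarith [sq_nonneg (a j)]
    push Not at hj
    set ρ := μ j / ν with hρ
    have hμρ : μ j = ρ * ν := by rw [hρ]; field_simp
    have hρ0 : 0 ≤ ρ := div_nonneg (hμ j) hν.le
    have hρ1 : ρ < 1 - ε / 2 := by rw [hρ, div_lt_iff₀ hν]; exact hj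
    have h1 : a j ^ 2 ≤ ρ ^ (2 * t) * R := by
      have := haj j
      rw [hμρ, mul_pow] at this
      have hp : 0 < ν ^ (2 * t) := by positivity
      refine le_of_mul_le_mul_left (this.trans (le_of_eq ?_)) hp
      ring
    have h2 : ρ ^ t ≤ η := pow_le_pow_left₀ hρ0 hρ1.le t
    have h3 := one_sub_mul_pow_le hρ0 (by linarith) t
    have h4 : (1 - ρ) * ρ ^ t ≤ ε := by
      have h5 : ρ ^ t ≤ ρ ^ (t - 1) := pow_le_pow_of_le_one hρ0 (by linarith) (by omega)
      have h6 : 0 ≤ (1 - ρ) * ρ ^ (t - 1) := mul_nonneg (by linarith) (by positivity)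
      have h7 : (1 - ρ) * ρ ^ (t - 1) ≤ ε := by nlinarith
      nlinarith
    have h8 : (1 - ρ) * ρ ^ (2 * t) ≤ ε * η := by
      rw [two_mul, pow_add, ← mul_assoc]
      exact mul_le_mul h4 h2 (by positivity) hε0.le
    calc (ν - μ j) * a j ^ 2 = ν * ((1 - ρ) * a j ^ 2) := by rw [hμρ]; ring
      _ ≤ ν * ((1 - ρ) * (ρ ^ (2 * t) * R)) := by
          gcongr; linarith
      _ = ν * ((1 - ρ) * ρ ^ (2 * t) * R) := by ring
      _ ≤ ν * (ε * η * R) := by gcongr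
      _ ≤ _ := by
          have : 0 ≤ ν * (ε / 2 * a j ^ 2) := by positivity
          linarith
  calc _ ≤ ∑ j, ν * (ε / 2 * a j ^ 2 + ε * (η * R)) := Finset.sum_le_sum fun j _ => key j
    _ = ν * (ε / 2 + d * (ε * (η * R))) := by
        rw [← Finset.mul_sum, Finset.sum_add_distrib, ← Finset.mul_sum, ha]
        simp
    _ ≤ ε * ν := by
        have : d * (ε * (η * R)) ≤ ε / 4 := by nlinarith
        nlinarith

/-- The second Rayleigh quotient cannot exceed the second eigenvalue by much, because the first
vector nearly takes up the top direction when the two eigenvalues differ. -/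
theorem sum_mul_sq_le_of_orthogonal {d : ℕ} {μ a b : Fin d → ℝ} {i₀ i₁ : Fin d} {ε R : ℝ} {t : ℕ}
    (hμ : ∀ j, 0 ≤ μ j) (hμ1 : ∀ j ≠ i₀, μ j ≤ μ i₁) (h10 : μ i₁ ≤ μ i₀)
    (hε0 : 0 < ε) (hε1 : ε ≤ 1) (hR : 0 ≤ R) (ht : 1 ≤ t)
    (htε : 1 ≤ t * ε) (hη : 4 * d * R * (1 - ε / 2) ^ t ≤ 1) (ha : ∑ j, a j ^ 2 = 1)
    (hb : ∑ j, b j ^ 2 = 1) (hab : ∑ j, a j * b j = 0)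
    (haj : ∀ j, μ i₀ ^ (2 * t) * a j ^ 2 ≤ μ j ^ (2 * t) * R) :
    ∑ j, μ j * b j ^ 2 ≤ (1 + ε) * μ i₁ := by
  have hb0 : b i₀ ^ 2 ≤ 1 := by
    rw [← hb]
    exact Finset.single_le_sum (f := fun j => b j ^ 2) (fun j _ => sq_nonneg _) (Finset.mem_univ _)
  have h1 : ∑ j, μ j * b j ^ 2 ≤ μ i₁ + (μ i₀ - μ i₁) * b i₀ ^ 2 := by
    have h2 : ∑ j, (μ j - μ i₁) * b j ^ 2 ≤ (μ i₀ - μ i₁) * b i₀ ^ 2 := by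
      rw [← Finset.add_sum_erase _ _ (Finset.mem_univ i₀)]
      have : ∑ j ∈ Finset.univ.erase i₀, (μ j - μ i₁) * b j ^ 2 ≤ 0 :=
        Finset.sum_nonpos fun j hj => mul_nonpos_of_nonpos_of_nonneg
          (sub_nonpos.2 (hμ1 j (Finset.ne_of_mem_erase hj))) (sq_nonneg _)
      linarith
    have h3 : ∑ j, (μ j - μ i₁) * b j ^ 2 = ∑ j, μ j * b j ^ 2 - μ i₁ := by
      simp only [sub_mul, Finset.sum_sub_distrib, ← Finset.mul_sum, hb, mul_one]
    linarith
  -- For eigenvalues this close, the excess in `h1` is already at most ε μ i₁. Otherwise ρ < 1/(1 +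
  -- ε) ≤ 1 - ε/2.
  rcases le_or_gt (μ i₀) ((1 + ε) * μ i₁) with hc | hc
  · nlinarith [hμ i₁]
  have hμ0 : 0 < μ i₀ := lt_of_le_of_lt (mul_nonneg (by linarith) (hμ _)) hc
  set η : ℝ := (1 - ε / 2) ^ t with hη'
  have hη0 : 0 ≤ η := pow_nonneg (by linarith) _
  set ρ := μ i₁ / μ i₀ with hρ
  have hμρ : μ i₁ = ρ * μ i₀ := by rw [hρ]; field_simp
  have hρ0 : 0 ≤ ρ := div_nonneg (hμ _) hμ0.le
  have hρ1 : ρ ≤ 1 - ε / 2 := by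
    rw [hρ, div_le_iff₀ hμ0]
    have : 0 ≤ μ i₁ := hμ _
    nlinarith
  have h2 : ρ ^ t ≤ η := pow_le_pow_left₀ hρ0 hρ1 t
  have hη1 : η ≤ 1 := pow_le_one₀ (by linarith) (by linarith)
  have hd : (1 : ℝ) ≤ d := by
    have : 0 < d := i₀.pos
    exact_mod_cast this
  have hajle : ∀ j ≠ i₀, a j ^ 2 ≤ ρ ^ (2 * t) * R := by
    intro j hj
    have h5 := haj j
    have h6 : μ j ^ (2 * t) ≤ (ρ * μ i₀) ^ (2 * t) := by
      rw [← hμρ]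
      exact pow_le_pow_left₀ (hμ j) (hμ1 j hj) _
    rw [mul_pow] at h6
    have hp : 0 < μ i₀ ^ (2 * t) := by positivity
    refine le_of_mul_le_mul_left (h5.trans ?_) hp
    have := mul_le_mul_of_nonneg_right h6 hR
    linarith
  set s := ∑ j ∈ Finset.univ.erase i₀, a j ^ 2 with hs
  have hs1 : s ≤ d * (ρ ^ (2 * t) * R) := by
    calc s ≤ ∑ j ∈ Finset.univ.erase i₀, ρ ^ (2 * t) * R :=
          Finset.sum_le_sum fun j hj => hajle j (Finset.ne_of_mem_erase hj)
      _ ≤ ∑ j : Fin d, ρ ^ (2 * t) * R := Finset.sum_le_sum_of_subset_of_nonneg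
          (Finset.subset_univ _) fun _ _ _ => by positivity
      _ = _ := by simp
  have hsplit : a i₀ ^ 2 + s = 1 := by
    rw [← ha, ← Finset.add_sum_erase _ _ (Finset.mem_univ i₀)]
  have hρ2 : ρ ^ (2 * t) ≤ η := by
    rw [two_mul, pow_add]
    exact (mul_le_mul h2 (h2.trans hη1) (pow_nonneg hρ0 t) hη0).trans_eq (mul_one _)
  have hsη : s ≤ 1 / 4 := by
    have : d * (ρ ^ (2 * t) * R) ≤ d * (η * R) := by gcongr
    linarith
  have ha0 : 1 / 2 ≤ a i₀ ^ 2 := by linarith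
  -- Orthogonality moves the product to the other coordinates, where Cauchy–Schwarz leaves the tail
  -- mass of `a`.
  have hcs : (a i₀ * b i₀) ^ 2 ≤ s := by
    have h3 : a i₀ * b i₀ = -∑ j ∈ Finset.univ.erase i₀, a j * b j := by
      rw [← Finset.add_sum_erase _ _ (Finset.mem_univ i₀)] at hab
      linarith
    have h4 := Finset.sum_mul_sq_le_sq_mul_sq (Finset.univ.erase i₀) a b
    have h5 : ∑ j ∈ Finset.univ.erase i₀, b j ^ 2 ≤ 1 := by
      rw [← hb]
      exact Finset.sum_le_sum_of_subset_of_nonneg (Finset.subset_univ _) fun _ _ _ => sq_nonneg _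
    have h6 : 0 ≤ s := Finset.sum_nonneg fun _ _ => sq_nonneg _
    rw [h3, neg_sq]
    exact h4.trans (mul_le_of_le_one_right h6 h5)
  have hb2 : b i₀ ^ 2 ≤ 2 * d * (ρ ^ (2 * t) * R) := by
    rw [mul_pow] at hcs
    have := mul_le_mul_of_nonneg_right ha0 (sq_nonneg (b i₀))
    linarith
  have h3 := one_sub_mul_pow_le hρ0 (by linarith) t
  have h7 : (1 - ρ) * ρ ^ (t - 1) ≤ ε := by
    have h6 : 0 ≤ (1 - ρ) * ρ ^ (t - 1) := mul_nonneg (by linarith) (by positivity)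
    nlinarith
  -- One factor ρ is set aside to turn μ i₀ into μ i₁, so that the error is relative to the second
  -- eigenvalue.
  have h8 : (1 - ρ) * ρ ^ (2 * t) ≤ ρ * (ε * η) := by
    have : (1 - ρ) * ρ ^ (2 * t) = ρ * ((1 - ρ) * ρ ^ (t - 1) * ρ ^ t) := by
      obtain ⟨u, rfl⟩ : ∃ u, t = u + 1 := ⟨t - 1, by omega⟩
      simp only [Nat.add_sub_cancel]
      ring
    rw [this]
    gcongr
  have h9 : (μ i₀ - μ i₁) * b i₀ ^ 2 ≤ ε * μ i₁ := by
    calc (μ i₀ - μ i₁) * b i₀ ^ 2 = μ i₀ * ((1 - ρ) * b i₀ ^ 2) := by rw [hμρ]; ring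
      _ ≤ μ i₀ * ((1 - ρ) * (2 * d * (ρ ^ (2 * t) * R))) := by
          gcongr; linarith
      _ = μ i₀ * ((1 - ρ) * ρ ^ (2 * t) * (2 * d * R)) := by ring
      _ ≤ μ i₀ * (ρ * (ε * η) * (2 * d * R)) := by gcongr
      _ = (ε * μ i₁) * (2 * d * R * η) := by rw [hμρ]; ring
      _ ≤ (ε * μ i₁) * 1 := by
          have : 0 ≤ ε * μ i₁ := mul_nonneg hε0.le (hμ _)
          have : 0 ≤ d * R * η := by positivity
          gcongr
          linarith
      _ = _ := mul_one _
  linarith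

/-! ### The block power method for a good start block. -/

/-- The rows of `G` are bounded by `B`, and its two top rows are well conditioned. -/
structure IsGoodBlock {d : ℕ} (hd : 2 ≤ d) (B τ : ℝ) (G : Matrix (Fin d) (Fin 2) ℝ) : Prop where
  row_le : ∀ j, G j 0 ^ 2 + G j 1 ^ 2 ≤ B
  le_comb : ∀ x y, τ * (x ^ 2 + y ^ 2) ≤
    (x * G (topIdx hd 0) 0 + y * G (topIdx hd 1) 0) ^ 2 +
      (x * G (topIdx hd 0) 1 + y * G (topIdx hd 1) 1) ^ 2

section Covariance

variable {d : ℕ} {V M : Matrix (Fin d) (Fin d) ℝ} {μ : Fin d → ℝ}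

theorem IsSortedDiag.transpose_pow_mul_mulVec_row (h : IsSortedDiag V M μ) (t : ℕ)
    (W : Matrix (Fin d) (Fin 2) ℝ) (j : Fin d) (b : Fin 2) :
    ((M ^ t * W)ᵀ *ᵥ V j) b = μ j ^ t * (V * W) j b := by
  have h1 : V * (M ^ t * W) = diagonal (fun j => μ j ^ t) * (V * W) := by
    rw [h.pow]
    simp only [← Matrix.mul_assoc]
    rw [h.orth, Matrix.one_mul]
  have h2 := congrFun (congrFun h1 j) b
  rw [diagonal_mul, Matrix.mul_apply'] at h2
  rw [← h2, mulVec_transpose]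
  rfl

theorem dotProduct_mul_transpose_mulVec (Y : Matrix (Fin d) (Fin 2) ℝ) (x : Fin d → ℝ) :
    x ⬝ᵥ ((Y * Yᵀ) *ᵥ x) = (Yᵀ *ᵥ x) 0 ^ 2 + (Yᵀ *ᵥ x) 1 ^ 2 := by
  rw [← mulVec_mulVec, dotProduct_mulVec, ← mulVec_transpose, dotProduct, Fin.sum_univ_two]
  ring

variable {hd : 2 ≤ d} {B τ : ℝ} {t : ℕ} {W : Matrix (Fin d) (Fin 2) ℝ}

/-- Coordinates of the singular vectors of `M ^ t * W` in the eigenbasis of `M`. -/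
theorem IsSortedDiag.eigenvalue_mul_coord_sq_le (h : IsSortedDiag V M μ)
    (hG : IsGoodBlock hd B τ (V * W)) {u : Fin d → ℝ} {s : ℝ} (hu : u ⬝ᵥ u = 1)
    (hs : ((M ^ t * W) * (M ^ t * W)ᵀ) *ᵥ u = s • u) (j : Fin d) :
    s * (V *ᵥ u) j ^ 2 ≤ μ j ^ (2 * t) * B := by
  set Y := M ^ t * W with hY
  set p := Yᵀ *ᵥ u with hp
  have h1 : p 0 ^ 2 + p 1 ^ 2 = s := by
    rw [← dotProduct_mul_transpose_mulVec, hs, dotProduct_smul, hu, smul_eq_mul, mul_one]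
  have h2 : s * (V *ᵥ u) j = μ j ^ t * ((V * W) j 0 * p 0 + (V * W) j 1 * p 1) := by
    have h3 : V j ⬝ᵥ ((Y * Yᵀ) *ᵥ u) = s * (V *ᵥ u) j := by
      rw [hs, dotProduct_smul]; rfl
    rw [← h3, ← mulVec_mulVec, dotProduct_mulVec, ← mulVec_transpose, dotProduct,
      Fin.sum_univ_two, h.transpose_pow_mul_mulVec_row, h.transpose_pow_mul_mulVec_row]
    ring
  have hs0 : 0 ≤ s := by rw [← h1]; positivity
  have hB := hG.row_le j
  have hB0 : 0 ≤ B := le_trans (by positivity) hB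
  rcases hs0.eq_or_lt with rfl | hs0
  · rw [zero_mul]
    exact mul_nonneg ((even_two_mul t).pow_nonneg _) hB0
  refine le_of_mul_le_mul_left ?_ hs0
  -- Cauchy–Schwarz for row j of V * W against p, whose squared length is s.
  have h4 : ((V * W) j 0 * p 0 + (V * W) j 1 * p 1) ^ 2 ≤ B * s := by
    rw [← h1]
    have : 0 ≤ p 0 ^ 2 + p 1 ^ 2 := by positivity
    nlinarith [sq_nonneg ((V * W) j 0 * p 1 - (V * W) j 1 * p 0),
      mul_le_mul_of_nonneg_right hB this]
  calc s * (s * (V *ᵥ u) j ^ 2) = (s * (V *ᵥ u) j) ^ 2 := by ring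
    _ = μ j ^ (2 * t) * ((V * W) j 0 * p 0 + (V * W) j 1 * p 1) ^ 2 := by
        rw [h2, mul_pow, ← pow_mul, mul_comm t]
    _ ≤ μ j ^ (2 * t) * (B * s) :=
        mul_le_mul_of_nonneg_left h4 ((even_two_mul t).pow_nonneg _)
    _ = _ := by ring

theorem IsSortedDiag.rayleigh_comb (h : IsSortedDiag V M μ) (hG : IsGoodBlock hd B τ (V * W))
    (x y : ℝ) :
    τ * ((x * μ (topIdx hd 0) ^ t) ^ 2 + (y * μ (topIdx hd 1) ^ t) ^ 2) ≤
      (x • V (topIdx hd 0) + y • V (topIdx hd 1)) ⬝ᵥ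
        (((M ^ t * W) * (M ^ t * W)ᵀ) *ᵥ (x • V (topIdx hd 0) + y • V (topIdx hd 1))) := by
  rw [dotProduct_mul_transpose_mulVec]
  simp only [mulVec_add, mulVec_smul, Pi.add_apply, Pi.smul_apply, smul_eq_mul,
    h.transpose_pow_mul_mulVec_row]
  refine (hG.le_comb _ _).trans (le_of_eq ?_)
  ring

variable {U : Matrix (Fin d) (Fin d) ℝ} {σ : Fin d → ℝ}

theorem IsSortedDiag.le_first (h : IsSortedDiag V M μ) (hG : IsGoodBlock hd B τ (V * W))
    (hU : IsSortedDiag U ((M ^ t * W) * (M ^ t * W)ᵀ) σ) :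
    τ * μ (topIdx hd 0) ^ (2 * t) ≤ σ (topIdx hd 0) := by
  have h1 := h.rayleigh_comb hG (t := t) 1 0
  rw [hU.dotProduct_mulVec_self] at h1
  set x := (1 : ℝ) • V (topIdx hd 0) + (0 : ℝ) • V (topIdx hd 1) with hx
  have hxx : x ⬝ᵥ x = 1 := by
    rw [hx, one_smul, zero_smul, add_zero, h.dotProduct_row, if_pos rfl]
  have h2 : ∑ j, σ j * (U *ᵥ x) j ^ 2 ≤ σ (topIdx hd 0) := by
    calc _ ≤ ∑ j, σ (topIdx hd 0) * (U *ᵥ x) j ^ 2 := Finset.sum_le_sum fun j _ =>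
          mul_le_mul_of_nonneg_right (hU.anti (topIdx_zero_le hd j)) (sq_nonneg _)
      _ = _ := by rw [← Finset.mul_sum, hU.sum_mulVec_sq, hxx, mul_one]
  refine le_trans (le_of_eq ?_) (h1.trans h2)
  ring

theorem IsSortedDiag.le_second (h : IsSortedDiag V M μ) (hμ : ∀ j, 0 ≤ μ j) (hτ : 0 ≤ τ)
    (hG : IsGoodBlock hd B τ (V * W))
    (hU : IsSortedDiag U ((M ^ t * W) * (M ^ t * W)ᵀ) σ) :
    τ * μ (topIdx hd 1) ^ (2 * t) ≤ σ (topIdx hd 1) := by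
  set i₀ := topIdx hd 0
  set i₁ := topIdx hd 1
  -- Courant–Fischer: the span of the top two eigenvectors of M contains a nonzero vector orthogonal
  -- to the first eigenvector of the covariance.
  obtain ⟨c, e, hce, hpos⟩ : ∃ c e : ℝ, c * (U *ᵥ V i₀) i₀ + e * (U *ᵥ V i₁) i₀ = 0 ∧
      0 < c ^ 2 + e ^ 2 := by
    by_cases h0 : (U *ᵥ V i₀) i₀ = 0
    · exact ⟨1, 0, by simp [h0], by norm_num⟩
    · exact ⟨-(U *ᵥ V i₁) i₀, (U *ᵥ V i₀) i₀, by ring, by positivity⟩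
  have h1 := h.rayleigh_comb hG (t := t) c e
  rw [hU.dotProduct_mulVec_self] at h1
  set x := c • V i₀ + e • V i₁ with hx
  have hne : i₀ ≠ i₁ := topIdx_zero_ne_one hd
  have hxx : x ⬝ᵥ x = c ^ 2 + e ^ 2 := by
    simp only [hx, add_dotProduct, dotProduct_add, smul_dotProduct, dotProduct_smul,
      h.dotProduct_row, if_neg hne, if_neg hne.symm, smul_eq_mul, if_true]
    ring
  have hx0 : (U *ᵥ x) i₀ = 0 := by
    rw [hx, mulVec_add, mulVec_smul, mulVec_smul]
    simpa using hce
  have h2 : ∑ j, σ j * (U *ᵥ x) j ^ 2 ≤ σ i₁ * (c ^ 2 + e ^ 2) := by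
    calc _ ≤ ∑ j, σ i₁ * (U *ᵥ x) j ^ 2 := Finset.sum_le_sum fun j _ => by
          by_cases hj : j = i₀
          · simp [hj, hx0]
          · exact mul_le_mul_of_nonneg_right (hU.anti (topIdx_one_le hd hj)) (sq_nonneg _)
      _ = _ := by rw [← Finset.mul_sum, hU.sum_mulVec_sq, hxx]
  have h3 : μ i₁ ^ t ≤ μ i₀ ^ t := pow_le_pow_left₀ (hμ _) (h.anti (topIdx_zero_le hd _)) t
  have h4 : (μ i₁ ^ t) ^ 2 ≤ (μ i₀ ^ t) ^ 2 := pow_le_pow_left₀ (pow_nonneg (hμ _) t) h3 2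
  refine le_of_mul_le_mul_right (le_trans ?_ (h1.trans h2)) hpos
  rw [mul_assoc]
  refine mul_le_mul_of_nonneg_left ?_ hτ
  rw [mul_comm 2 t, pow_mul, mul_pow, mul_pow]
  nlinarith [mul_le_mul_of_nonneg_left h4 (sq_nonneg c)]

/-- Accuracy of the block power method in terms of the start block. -/
theorem IsSortedDiag.abs_eigEstimate_sub_le (h : IsSortedDiag V M μ) (hμ : ∀ j, 0 ≤ μ j)
    (hτ : 0 < τ) (hG : IsGoodBlock hd B τ (V * W)) {ε : ℝ} (hε0 : 0 < ε) (hε1 : ε ≤ 1)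
    (ht : 1 ≤ t) (htε : 1 ≤ t * ε) (hη : 4 * d * (B / τ) * (1 - ε / 2) ^ t ≤ 1) (k : Fin 2) :
    |eigEstimate hd M (M ^ t * W) k - μ (topIdx hd k)| ≤ ε * μ (topIdx hd k) := by
  have hU := isSortedDiag_of_isHermitian (isHermitian_mul_transpose (M ^ t * W))
  set hH := isHermitian_mul_transpose (M ^ t * W)
  set σ := sortedEigenvalue hH
  set i₀ := topIdx hd 0 with hi₀
  set i₁ := topIdx hd 1 with hi₁
  have hunit : ∀ i, sortedEigenvector hH i ⬝ᵥ sortedEigenvector hH i = 1 := fun i => by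
    rw [sortedEigenvector_dotProduct, if_pos rfl]
  have hB0 : 0 ≤ B := le_trans (by positivity) (hG.row_le i₀)
  have hR : 0 ≤ B / τ := by positivity
  set a := V *ᵥ sortedEigenvector hH i₀ with ha
  set b := V *ᵥ sortedEigenvector hH i₁ with hb
  have ha1 : ∑ j, a j ^ 2 = 1 := by rw [ha, h.sum_mulVec_sq, hunit]
  have hb1 : ∑ j, b j ^ 2 = 1 := by rw [hb, h.sum_mulVec_sq, hunit]
  have hab : ∑ j, a j * b j = 0 := by
    rw [ha, hb, h.sum_mulVec_mul, sortedEigenvector_dotProduct, if_neg (topIdx_zero_ne_one hd)]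
  -- The lower bound on the covariance eigenvalue is divided out of the coordinate bound; B / τ
  -- takes the role of R.
  have coord : ∀ (ν s : ℝ) (c : Fin d → ℝ), τ * ν ^ (2 * t) ≤ s →
      (∀ j, s * c j ^ 2 ≤ μ j ^ (2 * t) * B) →
      ∀ j, ν ^ (2 * t) * c j ^ 2 ≤ μ j ^ (2 * t) * (B / τ) := by
    intro ν s c h1 h2 j
    rw [← mul_div_assoc, le_div_iff₀ hτ]
    refine le_trans ?_ (h2 j)
    have := mul_le_mul_of_nonneg_right h1 (sq_nonneg (c j))
    linarith
  have haj := coord _ _ a (h.le_first hG hU)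
    (h.eigenvalue_mul_coord_sq_le hG (hunit i₀) (mulVec_sortedEigenvector hH i₀))
  have hbj := coord _ _ b (h.le_second hμ hτ.le hG hU)
    (h.eigenvalue_mul_coord_sq_le hG (hunit i₁) (mulVec_sortedEigenvector hH i₁))
  have hlow : ∀ (ν : ℝ) (c : Fin d → ℝ), ∑ j, c j ^ 2 = 1 →
      ∑ j, (ν - μ j) * c j ^ 2 = ν - ∑ j, μ j * c j ^ 2 := by
    intro ν c hc
    simp only [sub_mul, Finset.sum_sub_distrib, ← Finset.mul_sum, hc, mul_one]
  have h0 : eigEstimate hd M (M ^ t * W) 0 = ∑ j, μ j * a j ^ 2 := h.dotProduct_mulVec_self _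
  have h1 : eigEstimate hd M (M ^ t * W) 1 = ∑ j, μ j * b j ^ 2 := h.dotProduct_mulVec_self _
  rw [abs_le]
  match k with
  | 0 =>
    have h2 := sum_sub_mul_sq_le hμ (hμ i₀) hε0 hε1 hR ht htε hη ha1 haj
    have h3 : 0 ≤ ∑ j, (μ i₀ - μ j) * a j ^ 2 := Finset.sum_nonneg fun j _ =>
      mul_nonneg (sub_nonneg.2 (h.anti (topIdx_zero_le hd j))) (sq_nonneg _)
    rw [hlow _ _ ha1] at h2 h3
    have := mul_nonneg hε0.le (hμ i₀)
    rw [h0]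
    constructor <;> linarith
  | 1 =>
    have h2 := sum_sub_mul_sq_le hμ (hμ i₁) hε0 hε1 hR ht htε hη hb1 hbj
    have h3 := sum_mul_sq_le_of_orthogonal hμ (fun j hj => h.anti (topIdx_one_le hd hj))
      (h.anti (topIdx_zero_le hd i₁)) hε0 hε1 hR ht htε hη ha1 hb1 hab haj
    rw [hlow _ _ hb1] at h2
    rw [h1]
    constructor <;> linarith

/-- The estimate is the Rayleigh quotient of a unit vector. This one-sidedness, valid for every Y,
is what makes the excess of the shift at least halve. -/
theorem IsSortedDiag.eigEstimate_zero_le (h : IsSortedDiag V M μ) (Y : Matrix (Fin d) (Fin 2) ℝ) :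
    eigEstimate hd M Y 0 ≤ μ (topIdx hd 0) := by
  have h0 : eigEstimate hd M Y 0 = _ := h.dotProduct_mulVec_self _
  rw [h0]
  calc _ ≤ ∑ j, μ (topIdx hd 0) *
        (V *ᵥ sortedEigenvector (isHermitian_mul_transpose Y) (topIdx hd 0)) j ^ 2 :=
        Finset.sum_le_sum fun j _ =>
          mul_le_mul_of_nonneg_right (h.anti (topIdx_zero_le hd j)) (sq_nonneg _)
    _ = _ := by
        rw [← Finset.mul_sum, h.sum_mulVec_sq, sortedEigenvector_dotProduct, if_pos rfl, mul_one]

end Covariance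

/-! ### The recursion for the shift and the exit test. -/

section Iteration

variable {n d : ℕ} {hd : 2 ≤ d} {A : Matrix (Fin n) (Fin d) ℝ} {α : ℝ} {t : ℕ}
  {W : ℕ → Matrix (Fin d) (Fin 2) ℝ}

theorem gramEig_zero_pos (hgap : 0 < gap hd A) : 0 < gramEig hd A 0 := by
  refine lt_of_le_of_ne (gramEig_nonneg A _) fun h => ?_
  rw [gap, ← h, div_zero] at hgap
  exact lt_irrefl _ hgap

theorem gap_mul_gramEig (hgap : 0 < gap hd A) :
    gap hd A * gramEig hd A 0 = gramEig hd A 0 - gramEig hd A 1 :=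
  div_mul_cancel₀ _ (gramEig_zero_pos hgap).ne'

theorem isSortedDiag_gram (A : Matrix (Fin n) (Fin d) ℝ) :
    IsSortedDiag (Matrix.of (sortedEigenvector (isHermitian_gram A))) (Aᵀ * A)
      (sortedEigenvalue (isHermitian_gram A)) :=
  isSortedDiag_of_isHermitian _

theorem sortedEigenvalue_gram_lt {s : ℝ} (hs : gramEig hd A 0 < s) (j : Fin d) :
    sortedEigenvalue (isHermitian_gram A) j < s :=
  lt_of_le_of_lt ((isSortedDiag_gram A).anti (topIdx_zero_le hd j)) hs

theorem sortedEigenvalue_shiftInv {s : ℝ} (hs : gramEig hd A 0 < s) (k : Fin 2) :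
    sortedEigenvalue (isHermitian_shiftInv A s) (topIdx hd k) = 1 / (s - gramEig hd A k) :=
  ((isSortedDiag_gram A).shiftInv (sortedEigenvalue_gram_lt hs)).sortedEigenvalue_eq _ _

theorem gramEig_one_le : gramEig hd A 1 ≤ gramEig hd A 0 :=
  (isSortedDiag_gram A).anti (topIdx_zero_le hd _)

/-- The factor 0.485 is 1.5 · 0.99 - 1. The exit test would force 0.35 times the first estimate
below -0.1 times the second, so the loop body runs at least once. -/
theorem lamBar_zero (hα : 100 < α) (h : CallAccurate hd A α t W 0) :
    485 / 1000 * gramEig hd A 0 ≤ (iterate hd A t W 0).lamBar - gramEig hd A 0 ∧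
      (iterate hd A t W 0).lamBar - gramEig hd A 0 ≤ gramEig hd A 0 / 2 ∧
      (0 < gramEig hd A 0 → ¬ (iterate hd A t W 0).ExitTest) := by
  have hdiv : ∀ k, gramEig hd A k / α ≤ gramEig hd A k / 100 := fun k =>
    div_le_div_of_nonneg_left (gramEig_nonneg A _) (by norm_num) hα.le
  have h0 := abs_le.1 ((h 0).trans (hdiv 0))
  have h1 := abs_le.1 ((h 1).trans (hdiv 1))
  have hle : (iterate hd A t W 0).lamTilde 0 ≤ gramEig hd A 0 :=
    (isSortedDiag_gram A).eigEstimate_zero_le _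
  have hbar : (iterate hd A t W 0).lamBar = (1 + 1 / 2) * (iterate hd A t W 0).lamTilde 0 := rfl
  have hn1 : 0 ≤ gramEig hd A 1 := gramEig_nonneg A _
  rw [Iterate.ExitTest, hbar]
  refine ⟨by linarith, by linarith, fun hpos hex => by linarith⟩

/-- Put D_k = s - lam_k and let h_k be the inverse of the k-th estimate. The new excess is D_0 -
h_0/2, and the exit test reads h_1 > 5.5 h_0. Since h_k / D_k lies in [100/101, 100/99], this
translates, after rounding, into comparisons of D_1 - D_0 with 4.39 D_0 and 4.62 D_0. -/
theorem lamBar_succ (hα : 100 < α) {i : ℕ} (h : CallAccurate hd A α t W (i + 1))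
    (hs : gramEig hd A 0 < (iterate hd A t W i).lamBar) :
    49 / 100 * ((iterate hd A t W i).lamBar - gramEig hd A 0)
        ≤ (iterate hd A t W (i + 1)).lamBar - gramEig hd A 0 ∧
      (iterate hd A t W (i + 1)).lamBar - gramEig hd A 0
        ≤ ((iterate hd A t W i).lamBar - gramEig hd A 0) / 2 ∧
      ((iterate hd A t W (i + 1)).ExitTest →
        439 / 100 * ((iterate hd A t W i).lamBar - gramEig hd A 0)
          ≤ gramEig hd A 0 - gramEig hd A 1) ∧
      (¬ (iterate hd A t W (i + 1)).ExitTest → gramEig hd A 0 - gramEig hd A 1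
        ≤ 462 / 100 * ((iterate hd A t W i).lamBar - gramEig hd A 0)) := by
  set s := (iterate hd A t W i).lamBar
  have hinv : ∀ k, 0 < s - gramEig hd A k →
      100 / 101 * (s - gramEig hd A k) ≤ 1 / lamHat hd A t s (W (i + 1)) k ∧
      1 / lamHat hd A t s (W (i + 1)) k ≤ 100 / 99 * (s - gramEig hd A k) := by
    intro k hk
    have h1 : |lamHat hd A t s (W (i + 1)) k
          - sortedEigenvalue (isHermitian_shiftInv A s) (topIdx hd k)|
        ≤ sortedEigenvalue (isHermitian_shiftInv A s) (topIdx hd k) / α := h k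
    rw [sortedEigenvalue_shiftInv hs] at h1
    have h2 : 1 / (s - gramEig hd A k) / α ≤ 1 / (s - gramEig hd A k) / 100 :=
      div_le_div_of_nonneg_left (by positivity) (by norm_num) hα.le
    have h3 := abs_le.1 (h1.trans h2)
    set D := s - gramEig hd A k
    set L := lamHat hd A t s (W (i + 1)) k
    have hDinv : D * (1 / D) = 1 := mul_one_div_cancel hk.ne'
    have hL : 0 < L := by
      have : 0 < 1 / D := by positivity
      linarith
    rw [le_div_iff₀ hL, div_le_iff₀ hL]
    constructor <;> nlinarith
  have hD : 0 < s - gramEig hd A 0 := sub_pos.2 hs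
  have hD2 : 0 < s - gramEig hd A 1 := by linarith [gramEig_one_le (hd := hd) (A := A)]
  have h0 := hinv 0 hD
  have h1 := hinv 1 hD2
  -- Accuracy alone would only give the contraction factor 51/101; the one-sided bound gives 1/2.
  have h0' : s - gramEig hd A 0 ≤ 1 / lamHat hd A t s (W (i + 1)) 0 := by
    have hle : lamHat hd A t s (W (i + 1)) 0 ≤ 1 / (s - gramEig hd A 0) :=
      ((isSortedDiag_gram A).shiftInv (sortedEigenvalue_gram_lt hs)).eigEstimate_zero_le _
    have hpos : 0 < lamHat hd A t s (W (i + 1)) 0 := by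
      have : 0 < 1 / lamHat hd A t s (W (i + 1)) 0 := by linarith
      exact one_div_pos.1 this
    exact (le_one_div hD hpos).2 hle
  have hbar : (iterate hd A t W (i + 1)).lamBar
      = (1 / 2) * ((s - 1 / lamHat hd A t s (W (i + 1)) 0) + s) := rfl
  have htil : ∀ k, (iterate hd A t W (i + 1)).lamTilde k
      = s - 1 / lamHat hd A t s (W (i + 1)) k := fun _ => rfl
  rw [Iterate.ExitTest, hbar, htil, htil]
  refine ⟨by linarith, by linarith, fun hex => by linarith, fun hex => by linarith⟩

/-- The exit test plays no role here, so the shift is controlled even past the exit. -/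
theorem lamBar_sub_bounds (hα : 100 < α) (hpos : 0 < gramEig hd A 0) (i : ℕ)
    (h : ∀ j ≤ i, CallAccurate hd A α t W j) :
    0 < (iterate hd A t W i).lamBar - gramEig hd A 0 ∧
      (iterate hd A t W i).lamBar - gramEig hd A 0 ≤ gramEig hd A 0 / 2 ^ (i + 1) := by
  induction i with
  | zero =>
    obtain ⟨h1, h2, -⟩ := lamBar_zero hα (h 0 le_rfl)
    exact ⟨by linarith, by simpa using h2⟩
  | succ i ih =>
    obtain ⟨ih1, ih2⟩ := ih fun j hj => h j (by omega)
    obtain ⟨h1, h2, -⟩ := lamBar_succ hα (h (i + 1) le_rfl) (sub_pos.1 ih1)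
    refine ⟨by linarith, h2.trans ?_⟩
    rw [pow_succ, ← div_div]
    linarith

/-- The constant comes from 0.49 / 4.62 > 1/10; at the initialization 0.485 is more than enough. -/
theorem le_lamBar_sub_of_not_exit (hα : 100 < α) (hpos : 0 < gramEig hd A 0) (i : ℕ)
    (h : ∀ j ≤ i, CallAccurate hd A α t W j) (hex : ¬ (iterate hd A t W i).ExitTest) :
    1 / 10 * (gramEig hd A 0 - gramEig hd A 1)
      ≤ (iterate hd A t W i).lamBar - gramEig hd A 0 := by
  match i with
  | 0 =>
    have := lamBar_zero hα (h 0 le_rfl)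
    have hn1 : 0 ≤ gramEig hd A 1 := gramEig_nonneg A _
    linarith
  | i + 1 =>
    obtain ⟨h1, -⟩ := lamBar_sub_bounds hα hpos i fun j hj => h j (by omega)
    obtain ⟨h2, -, -, h3⟩ := lamBar_succ hα (h (i + 1) le_rfl) (sub_pos.1 h1)
    have := h3 hex
    linarith

theorem CallsAccurate.succeeds (hgap : 0 < gap hd A) (hα : 100 < α)
    (h : CallsAccurate hd A α t W) : Succeeds hd A t W := by
  have hpos := gramEig_zero_pos hgap
  have hg := gap_mul_gramEig hgap
  have hexists : ∃ T, T ≤ maxIter hd A ∧ (iterate hd A t W T).ExitTest := by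
    by_contra! hno
    have hacc : ∀ j ≤ maxIter hd A, CallAccurate hd A α t W j := fun j hj =>
      h j hj fun k hk => hno k (by omega)
    rw [maxIter] at hacc hno
    set L := ⌈Real.logb 2 (10 / gap hd A)⌉₊ with hL
    obtain ⟨h1, h2⟩ := lamBar_sub_bounds hα hpos L fun j hj => hacc j (by omega)
    obtain ⟨-, -, -, h3⟩ := lamBar_succ hα (hacc (L + 1) le_rfl) (sub_pos.1 h1)
    have h4 := h3 (hno (L + 1) le_rfl)
    -- This gives 2 ^ L · gap ≥ 10, whereas a failed test at step L + 1 bounds 2 ^ (L + 1) · gap by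
    -- 4.62.
    have h5 : 10 / gap hd A ≤ 2 ^ L := by
      have : Real.logb 2 (10 / gap hd A) ≤ L := Nat.le_ceil _
      rw [Real.logb_le_iff_le_rpow (by norm_num) (by positivity)] at this
      exact_mod_cast this
    rw [div_le_iff₀ hgap] at h5
    have hp : (0 : ℝ) < 2 ^ (L + 1) := by positivity
    rw [le_div_iff₀ hp, pow_succ] at h2
    have hp' : (0 : ℝ) < 2 ^ L := by positivity
    have h6 : gap hd A * gramEig hd A 0 * (2 ^ L * 2) ≤ 462 / 100 * gramEig hd A 0 := by
      rw [hg]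
      calc _ ≤ 462 / 100 * ((iterate hd A t W L).lamBar - gramEig hd A 0) * (2 ^ L * 2) := by
            gcongr
        _ ≤ _ := by linarith
    have h7 : 10 * gramEig hd A 0 ≤ 2 ^ L * gap hd A * gramEig hd A 0 := by gcongr
    linarith
  classical
  have hfind : ∃ T, (iterate hd A t W T).ExitTest := ⟨_, hexists.choose_spec.2⟩
  have hmin : ∀ i < Nat.find hfind, ¬ (iterate hd A t W i).ExitTest := fun i hi =>
    Nat.find_min hfind hi
  have hT := Nat.find_spec hfind
  have hTle : Nat.find hfind ≤ maxIter hd A := by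
    obtain ⟨T, hT1, hT2⟩ := hexists
    exact (Nat.find_min' hfind hT2).trans hT1
  have hacc : ∀ j ≤ Nat.find hfind, CallAccurate hd A α t W j := fun j hj =>
    h j (hj.trans hTle) fun k hk => hmin k (by omega)
  refine ⟨Nat.find hfind, ⟨hT, hmin⟩, hTle, ?_⟩
  revert hT hmin hacc
  generalize Nat.find hfind = T
  intro hmin hT hacc
  match T with
  | 0 => exact absurd hT ((lamBar_zero hα (hacc 0 le_rfl)).2.2 hpos)
  | i + 1 =>
    have hacc' : ∀ j ≤ i, CallAccurate hd A α t W j := fun j hj => hacc j (by omega)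
    obtain ⟨h1, -⟩ := lamBar_sub_bounds hα hpos i hacc'
    have h2 := le_lamBar_sub_of_not_exit hα hpos i hacc' (hmin i (by omega))
    obtain ⟨h3, h4, h5, -⟩ := lamBar_succ hα (hacc (i + 1) le_rfl) (sub_pos.1 h1)
    have h6 := h5 hT
    -- Lower bound: 0.49 · 1/10 ≥ 1/120. Upper bound: 1/(2 · 4.39) ≤ 1/8.
    constructor <;> linarith

/-- Start blocks that are good in the eigenbasis of `Aᵀ A` make every call accurate. -/
theorem callAccurate_of_isGoodBlock (hgap : 0 < gap hd A) (hα : 100 < α) {B τ : ℝ} (hτ : 0 < τ)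
    (ht : 1 ≤ t) (htα : α ≤ t) (hη : 4 * d * (B / τ) * (1 - α⁻¹ / 2) ^ t ≤ 1) (N : ℕ)
    (hG : ∀ i ≤ N, IsGoodBlock hd B τ
      (Matrix.of (sortedEigenvector (isHermitian_gram A)) * W i)) :
    ∀ i ≤ N, CallAccurate hd A α t W i := by
  have hpos := gramEig_zero_pos hgap
  have hα0 : 0 < α := by linarith
  have hε1 : α⁻¹ ≤ 1 := inv_le_one_of_one_le₀ (by linarith)
  have htε : 1 ≤ t * α⁻¹ := by
    rw [← div_eq_mul_inv, le_div_iff₀ hα0]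
    linarith
  -- Accuracy of the earlier calls puts the current shift above lam1, so the shifted inverse is
  -- positive and diagonalized by the same V, to which `hG` applies.
  intro i
  induction i using Nat.strong_induction_on with
  | _ i ih =>
    intro hi
    match i with
    | 0 =>
      intro k
      rw [div_eq_inv_mul]
      exact (isSortedDiag_gram A).abs_eigEstimate_sub_le (gramEig_nonneg A) hτ (hG 0 hi)
        (inv_pos.2 hα0) hε1 ht htε hη k
    | i + 1 =>
      obtain ⟨h1, -⟩ := lamBar_sub_bounds hα hpos i fun j hj => ih j (by omega) (by omega)
      have hs := sub_pos.1 h1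
      intro k
      have hlt := sortedEigenvalue_gram_lt hs
      rw [sortedEigenvalue_shiftInv hs, div_eq_inv_mul _ α]
      exact ((isSortedDiag_gram A).shiftInv hlt).abs_eigEstimate_sub_le
        (fun j => one_div_nonneg.2 (sub_pos.2 (hlt j)).le) hτ (hG _ hi)
        (inv_pos.2 hα0) hε1 ht htε hη k

end Iteration

/-! ### One-dimensional Gaussian bounds and slicing of product measures. -/

theorem gaussianReal_le_volume (s : Set ℝ) : gaussianReal 0 1 s ≤ volume s := by
  rw [gaussianReal_apply 0 one_ne_zero]
  calc ∫⁻ x in s, gaussianPDF 0 1 x ≤ ∫⁻ _ in s, 1 := by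
        refine lintegral_mono fun x => ?_
        rw [gaussianPDF, ← ENNReal.ofReal_one]
        refine ENNReal.ofReal_le_ofReal ?_
        rw [gaussianPDFReal]
        have h1 : (√(2 * Real.pi * (1 : NNReal)))⁻¹ ≤ 1 := by
          refine inv_le_one_of_one_le₀ (Real.one_le_sqrt.2 ?_)
          have := Real.pi_gt_three
          simp only [NNReal.coe_one]
          linarith
        have h2 : Real.exp (-(x - 0) ^ 2 / (2 * (1 : NNReal))) ≤ 1 := by
          refine Real.exp_le_one_iff.2 ?_
          simp only [NNReal.coe_one]
          have := sq_nonneg (x - 0)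
          linarith
        exact mul_le_one₀ h1 (Real.exp_pos _).le h2
    _ = volume s := by simp

/-- The event is contained in an interval of length 2δ/|a|, and the density is at most 1. -/
theorem gaussianReal_abs_affine_lt_le {a κ : ℝ} (z δ : ℝ) (hκ : 0 < κ) (ha : κ ≤ |a|)
    (hδ : 0 ≤ δ) :
    gaussianReal 0 1 {x | |a * x + z| < δ} ≤ ENNReal.ofReal (2 * δ / κ) := by
  have ha0 : 0 < |a| := hκ.trans_le ha
  have hane : a ≠ 0 := abs_pos.1 ha0
  have hsub : {x | |a * x + z| < δ} ⊆ Metric.ball (-z / a) (δ / |a|) := by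
    intro x hx
    rw [Metric.mem_ball, Real.dist_eq, lt_div_iff₀ ha0, ← abs_mul]
    have : (x - -z / a) * a = a * x + z := by field_simp; ring
    rwa [this]
  calc _ ≤ volume (Metric.ball (-z / a) (δ / |a|)) :=
        (gaussianReal_le_volume _).trans (measure_mono hsub)
    _ = ENNReal.ofReal (2 * (δ / |a|)) := Real.volume_ball _ _
    _ ≤ _ := by
        refine ENNReal.ofReal_le_ofReal ?_
        rw [← mul_div_assoc]
        gcongr

theorem gaussianReal_le_abs_le {s : ℝ} (hs : 0 < s) :
    gaussianReal 0 1 {x | s ≤ |x|} ≤ ENNReal.ofReal (1 / s ^ 2) := by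
  have h := meas_ge_le_variance_div_sq (μ := gaussianReal 0 1) (X := id) (memLp_id_gaussianReal 2) hs
  simpa [variance_id_gaussianReal] using h

/-- A bound for all slices along one coordinate bounds the product measure. -/
theorem pi_le_of_update_le {ι : Type*} [Fintype ι] [DecidableEq ι] (γ : Measure ℝ)
    [IsProbabilityMeasure γ] {S : Set (ι → ℝ)} (hS : MeasurableSet S) (p : ι) {c : ENNReal}
    (h : ∀ w : ι → ℝ, γ {x | Function.update w p x ∈ S} ≤ c) :
    Measure.pi (fun _ : ι => γ) S ≤ c := by
  have h1 : ∫⁻ w, S.indicator 1 w ∂Measure.pi (fun _ : ι => γ) ≤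
      ∫⁻ _, c ∂Measure.pi (fun _ : ι => γ) := by
    refine lintegral_le_of_lmarginal_le {p} (measurable_one.indicator hS) measurable_const ?_
    intro w
    rw [lmarginal_singleton, lmarginal_singleton]
    have h2 : ∀ x, S.indicator (1 : (ι → ℝ) → ENNReal) (Function.update w p x)
        = (Function.update w p ⁻¹' S).indicator 1 x := by
      intro x
      by_cases hx : Function.update w p x ∈ S
      · rw [Set.indicator_of_mem hx, Set.indicator_of_mem (show x ∈ _ ⁻¹' S from hx)]
        rfl
      · rw [Set.indicator_of_notMem hx, Set.indicator_of_notMem (show x ∉ _ ⁻¹' S from hx)]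
    change ∫⁻ x, S.indicator 1 (Function.update w p x) ∂γ ≤ ∫⁻ _, c ∂γ
    rw [lintegral_congr h2, lintegral_indicator_one (measurable_update w hS)]
    simpa using! h w
  simpa [lintegral_indicator_one hS] using h1

/-! ### The top minor of a Gaussian block. -/

section Block

variable {d : ℕ}

/-- The coefficient of `w (k, 0)` in the top minor of `V * W`, as a linear form in the second
column of the block. -/
def minorCoeff (v₁ v₂ : Fin d → ℝ) (w : Fin d × Fin 2 → ℝ) (k : Fin d) : ℝ :=
  ∑ l, (v₁ k * v₂ l - v₂ k * v₁ l) * w (l, 1)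

theorem measurable_minorCoeff (v₁ v₂ : Fin d → ℝ) (k : Fin d) :
    Measurable fun w => minorCoeff v₁ v₂ w k := by
  unfold minorCoeff
  fun_prop

/-- By Lagrange's identity the squares of the d² expressions add up to 2, so they cannot all be
below 1/d². -/
theorem exists_minor_ge {v₁ v₂ : Fin d → ℝ} (h1 : v₁ ⬝ᵥ v₁ = 1) (h2 : v₂ ⬝ᵥ v₂ = 1)
    (h12 : v₁ ⬝ᵥ v₂ = 0) : ∃ k l, 1 / (d : ℝ) ≤ |v₁ k * v₂ l - v₂ k * v₁ l| := by
  by_contra! hno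
  have hsum : ∑ k, ∑ l, (v₁ k * v₂ l - v₂ k * v₁ l) ^ 2 = 2 := by
    have : ∀ k, ∑ l, (v₁ k * v₂ l - v₂ k * v₁ l) ^ 2
        = v₁ k * v₁ k * (v₂ ⬝ᵥ v₂) - 2 * (v₁ k * v₂ k) * (v₁ ⬝ᵥ v₂)
          + v₂ k * v₂ k * (v₁ ⬝ᵥ v₁) := by
      intro k
      simp only [dotProduct, Finset.mul_sum, ← Finset.sum_sub_distrib, ← Finset.sum_add_distrib]
      exact Finset.sum_congr rfl fun l _ => by ring
    simp only [this, h1, h2, h12, mul_one, mul_zero, sub_zero, Finset.sum_add_distrib]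
    change v₁ ⬝ᵥ v₁ + v₂ ⬝ᵥ v₂ = 2
    rw [h1, h2]; norm_num
  have hle : ∑ k : Fin d, ∑ l : Fin d, (v₁ k * v₂ l - v₂ k * v₁ l) ^ 2
      ≤ ∑ _k : Fin d, ∑ _l : Fin d, (1 / (d : ℝ)) ^ 2 :=
    Finset.sum_le_sum fun k _ => Finset.sum_le_sum fun l _ => by
      rw [← sq_abs]
      exact pow_le_pow_left₀ (abs_nonneg _) (hno k l).le 2
  rw [hsum] at hle
  simp only [Finset.sum_const, Finset.card_univ, Fintype.card_fin, nsmul_eq_mul] at hle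
  rcases Nat.eq_zero_or_pos d with h0 | h0
  · rw [h0] at hle; norm_num at hle
  · have : (d : ℝ) * (d * (1 / d) ^ 2) = 1 := by field_simp
    linarith

/-- As a function of the entry (l, 1) alone, the coefficient is affine with slope the given minor.
-/
theorem pi_abs_minorCoeff_lt_le {v₁ v₂ : Fin d → ℝ} {k l : Fin d} {κ κ₀ : ℝ} (hκ₀ : 0 < κ₀)
    (hκ : 0 ≤ κ) (hkl : κ₀ ≤ |v₁ k * v₂ l - v₂ k * v₁ l|) :
    Measure.pi (fun _ : Fin d × Fin 2 => gaussianReal 0 1) {w | |minorCoeff v₁ v₂ w k| < κ}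
      ≤ ENNReal.ofReal (2 * κ / κ₀) := by
  refine pi_le_of_update_le _ ?_ (l, 1) fun w => ?_
  · exact measurableSet_lt (measurable_minorCoeff v₁ v₂ k).abs measurable_const
  · refine le_trans (le_of_eq ?_) (gaussianReal_abs_affine_lt_le
      (∑ j ∈ Finset.univ.erase l, (v₁ k * v₂ j - v₂ k * v₁ j) * w (j, 1)) κ hκ₀ hkl hκ)
    congr 1
    ext x
    simp only [Set.mem_ofPred_eq, minorCoeff]
    rw [← Finset.add_sum_erase _ _ (Finset.mem_univ l), Function.update_self]
    rw [Finset.sum_congr rfl fun j hj => by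
      rw [Function.update_of_ne (by simpa using Finset.ne_of_mem_erase hj)]]

/-- The coefficients involve only the second column, so they stay fixed while the entry (k, 0)
varies, and the minor is affine in that entry with slope `minorCoeff v₁ v₂ w k`. -/
theorem pi_abs_minor_lt_le (v₁ v₂ : Fin d → ℝ) (k : Fin d) {κ δ : ℝ} (hκ : 0 < κ) (hδ : 0 ≤ δ) :
    Measure.pi (fun _ : Fin d × Fin 2 => gaussianReal 0 1)
        {w | κ ≤ |minorCoeff v₁ v₂ w k| ∧ |∑ j, w (j, 0) * minorCoeff v₁ v₂ w j| < δ}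
      ≤ ENNReal.ofReal (2 * δ / κ) := by
  refine pi_le_of_update_le _ ?_ (k, 0) fun w => ?_
  · have h1 : Measurable fun w : Fin d × Fin 2 → ℝ => ∑ j, w (j, 0) * minorCoeff v₁ v₂ w j := ?_
    · exact (measurableSet_le measurable_const (measurable_minorCoeff v₁ v₂ k).abs).inter
        (measurableSet_lt h1.abs measurable_const)
    exact Finset.measurable_sum _ fun j _ =>
      (measurable_pi_apply _).mul (measurable_minorCoeff v₁ v₂ j)
  · have hc : ∀ x j, minorCoeff v₁ v₂ (Function.update w (k, 0) x) j = minorCoeff v₁ v₂ w j := by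
      intro x j
      simp [minorCoeff]
    simp only [Set.mem_ofPred_eq, hc]
    by_cases hk : κ ≤ |minorCoeff v₁ v₂ w k|
    · refine le_trans (le_of_eq ?_) (gaussianReal_abs_affine_lt_le
        (∑ j ∈ Finset.univ.erase k, w (j, 0) * minorCoeff v₁ v₂ w j) δ hκ hk hδ)
      congr 1
      ext x
      simp only [Set.mem_ofPred_eq, hk, true_and]
      rw [← Finset.add_sum_erase _ _ (Finset.mem_univ k), Function.update_self, mul_comm x]
      rw [Finset.sum_congr rfl fun j hj => by
        rw [Function.update_of_ne (by simpa using Finset.ne_of_mem_erase hj)]]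
    · simp [hk]

/-- Chebyshev and a union bound over the 2d entries. A polynomial tail is enough, since only the
logarithm of the spread enters the power t. -/
theorem pi_exists_le_abs_le {s : ℝ} (hs : 0 < s) :
    Measure.pi (fun _ : Fin d × Fin 2 => gaussianReal 0 1) {w | ∃ p, s ≤ |w p|}
      ≤ ENNReal.ofReal (2 * d / s ^ 2) := by
  have h1 : {w : Fin d × Fin 2 → ℝ | ∃ p, s ≤ |w p|} = ⋃ p, {w | s ≤ |w p|} := by
    ext w; simp
  rw [h1]
  calc _ ≤ ∑ p : Fin d × Fin 2, Measure.pi (fun _ : Fin d × Fin 2 => gaussianReal 0 1)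
        {w | s ≤ |w p|} := measure_iUnion_fintype_le _ _
    _ ≤ ∑ _p : Fin d × Fin 2, ENNReal.ofReal (1 / s ^ 2) := by
        refine Finset.sum_le_sum fun p _ => pi_le_of_update_le _ ?_ p fun w => ?_
        · exact measurableSet_le measurable_const (measurable_pi_apply p).abs
        · simpa using gaussianReal_le_abs_le hs
    _ = _ := by
        rw [Finset.sum_const, nsmul_eq_mul, ← ENNReal.ofReal_natCast,
          ← ENNReal.ofReal_mul (by positivity)]
        congr 1
        simp only [Finset.card_univ, Fintype.card_prod, Fintype.card_fin]
        push_cast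
        ring

/-- Cramer's rule recovers (x, y) from the combination (p, r) at the cost of the determinant, and
the entries of V * W are bounded because V has unit rows. -/
theorem isGoodBlock_of_minor (hd : 2 ≤ d) {V : Matrix (Fin d) (Fin d) ℝ} (hV : V * Vᵀ = 1)
    {w : Fin d × Fin 2 → ℝ} {s δ : ℝ} (hs : 0 < s) (hδ : 0 ≤ δ) (hw : ∀ p, |w p| ≤ s)
    (hdet : δ ≤ |∑ j, w (j, 0) * minorCoeff (V (topIdx hd 0)) (V (topIdx hd 1)) w j|) :
    IsGoodBlock hd (2 * d * s ^ 2) (δ ^ 2 / (4 * d * s ^ 2))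
      (V * Matrix.of fun a b => w (a, b)) := by
  have hd0 : (0 : ℝ) < d := by
    have : 0 < d := by omega
    exact_mod_cast this
  set G := V * Matrix.of fun a b => w (a, b) with hG
  have hGe : ∀ j b, G j b = ∑ a, V j a * w (a, b) := fun j b => by
    simp [hG, Matrix.mul_apply]
  have hrow : ∀ j b, G j b ^ 2 ≤ d * s ^ 2 := by
    intro j b
    have h1 := Finset.sum_mul_sq_le_sq_mul_sq Finset.univ (V j) (fun a => w (a, b))
    have h2 : ∑ a, V j a ^ 2 = 1 := by
      have := congrFun (congrFun hV j) j
      rw [Matrix.mul_apply, one_apply_eq] at this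
      simpa [sq] using this
    have h3 : ∑ a, w (a, b) ^ 2 ≤ d * s ^ 2 := by
      calc _ ≤ ∑ _a : Fin d, s ^ 2 := Finset.sum_le_sum fun a _ => by
            rw [← sq_abs]
            exact pow_le_pow_left₀ (abs_nonneg _) (hw _) 2
        _ = _ := by simp
    rw [h2, one_mul, ← hGe] at h1
    exact h1.trans h3
  refine ⟨fun j => by linarith [hrow j 0, hrow j 1], fun x y => ?_⟩
  set g00 := G (topIdx hd 0) 0
  set g01 := G (topIdx hd 0) 1
  set g10 := G (topIdx hd 1) 0
  set g11 := G (topIdx hd 1) 1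
  have hminor : ∑ j, w (j, 0) * minorCoeff (V (topIdx hd 0)) (V (topIdx hd 1)) w j
      = g00 * g11 - g01 * g10 := by
    have h1 : ∀ j, w (j, 0) * minorCoeff (V (topIdx hd 0)) (V (topIdx hd 1)) w j
        = V (topIdx hd 0) j * w (j, 0) * g11 - V (topIdx hd 1) j * w (j, 0) * g01 := by
      intro j
      simp only [minorCoeff, g11, g01, hGe, Finset.mul_sum, ← Finset.sum_sub_distrib]
      exact Finset.sum_congr rfl fun l _ => by ring
    simp only [h1, Finset.sum_sub_distrib, ← Finset.sum_mul]
    rw [← hGe, ← hGe]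
    ring
  rw [hminor] at hdet
  set D := g00 * g11 - g01 * g10 with hD
  have hD2 : δ ^ 2 ≤ D ^ 2 := by
    rw [← sq_abs D]
    exact pow_le_pow_left₀ hδ hdet 2
  set p := x * g00 + y * g10 with hp
  set r := x * g01 + y * g11 with hr
  have h1 : x * D = p * g11 - r * g10 := by rw [hD, hp, hr]; ring
  have h2 : y * D = r * g00 - p * g01 := by rw [hD, hp, hr]; ring
  have h3 : (x * D) ^ 2 ≤ (p ^ 2 + r ^ 2) * (g11 ^ 2 + g10 ^ 2) := by
    rw [h1]
    linarith [sq_nonneg (p * g10 + r * g11)]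
  have h4 : (y * D) ^ 2 ≤ (p ^ 2 + r ^ 2) * (g00 ^ 2 + g01 ^ 2) := by
    rw [h2]
    linarith [sq_nonneg (p * g00 + r * g01)]
  have h5 : g00 ^ 2 + g01 ^ 2 + g10 ^ 2 + g11 ^ 2 ≤ 4 * d * s ^ 2 := by
    linarith [hrow (topIdx hd 0) 0, hrow (topIdx hd 0) 1, hrow (topIdx hd 1) 0,
      hrow (topIdx hd 1) 1]
  rw [div_mul_eq_mul_div, div_le_iff₀ (by positivity)]
  have h6 := mul_le_mul_of_nonneg_left h5 (by positivity : 0 ≤ p ^ 2 + r ^ 2)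
  have h7 := mul_le_mul_of_nonneg_right hD2 (by positivity : 0 ≤ x ^ 2 + y ^ 2)
  linarith

end Block

/-! ### Choice of constants. -/

/-- The spread of a Gaussian start block that is good with probability `1 - d ^ (-q)`. -/
noncomputable def blockBound (d q : ℕ) : ℝ := 8 * (d : ℝ) ^ (q + 2)

/-- The conditioning of a Gaussian start block that is good with probability `1 - d ^ (-q)`. -/
noncomputable def blockCond (d q : ℕ) : ℝ := (1 / (64 * (d : ℝ) ^ (2 * q + 1))) ^ 2 / (16 * (d : ℝ) ^ (q + 2))

theorem exists_measurableSet_not_isGoodBlock {d : ℕ} (hd : 2 ≤ d) (q : ℕ)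
    {V : Matrix (Fin d) (Fin d) ℝ} (hV : V * Vᵀ = 1) :
    ∃ S : Set (Fin d × Fin 2 → ℝ), MeasurableSet S ∧
      Measure.pi (fun _ : Fin d × Fin 2 => gaussianReal 0 1) S ≤ ENNReal.ofReal (1 / (d : ℝ) ^ q) ∧
      ∀ w ∉ S, IsGoodBlock hd (blockBound d q) (blockCond d q)
        (V * Matrix.of fun a b => w (a, b)) := by
  have hd0 : (0 : ℝ) < d := by
    have : 0 < d := by omega
    exact_mod_cast this
  have hrow : ∀ i j, V i ⬝ᵥ V j = if i = j then 1 else 0 := by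
    intro i j
    have := congrFun (congrFun hV i) j
    rw [Matrix.mul_apply', one_apply] at this
    exact this
  set v₁ := V (topIdx hd 0)
  set v₂ := V (topIdx hd 1)
  obtain ⟨k, l, hkl⟩ := exists_minor_ge (v₁ := v₁) (v₂ := v₂) (by rw [hrow, if_pos rfl])
    (by rw [hrow, if_pos rfl]) (by rw [hrow, if_neg (topIdx_zero_ne_one hd)])
  -- The values of s, κ and δ give the three bad events the shares 1/2, 1/4 and 1/4 of d ^ (-q).
  set s : ℝ := √(4 * (d : ℝ) ^ (q + 1)) with hs
  have hs2 : s ^ 2 = 4 * (d : ℝ) ^ (q + 1) := Real.sq_sqrt (by positivity)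
  have hs0 : 0 < s := Real.sqrt_pos.2 (by positivity)
  set κ : ℝ := 1 / (8 * (d : ℝ) ^ (q + 1)) with hκ
  set δ : ℝ := 1 / (64 * (d : ℝ) ^ (2 * q + 1)) with hδ
  have hκ0 : 0 < κ := by positivity
  have hδ0 : 0 < δ := by positivity
  set γ := Measure.pi (fun _ : Fin d × Fin 2 => gaussianReal 0 1)
  have e1 : γ {w | ∃ p, s ≤ |w p|} ≤ ENNReal.ofReal (1 / (2 * (d : ℝ) ^ q)) := by
    refine (pi_exists_le_abs_le hs0).trans (ENNReal.ofReal_le_ofReal (le_of_eq ?_))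
    rw [hs2]
    field_simp
    ring
  have e2 : γ {w | |minorCoeff v₁ v₂ w k| < κ} ≤ ENNReal.ofReal (1 / (4 * (d : ℝ) ^ q)) := by
    refine (pi_abs_minorCoeff_lt_le (by positivity) hκ0.le hkl).trans
      (ENNReal.ofReal_le_ofReal (le_of_eq ?_))
    rw [hκ]
    field_simp
    ring
  have e3 : γ {w | κ ≤ |minorCoeff v₁ v₂ w k| ∧ |∑ j, w (j, 0) * minorCoeff v₁ v₂ w j| < δ}
      ≤ ENNReal.ofReal (1 / (4 * (d : ℝ) ^ q)) := by
    refine (pi_abs_minor_lt_le v₁ v₂ k hκ0 hδ0.le).trans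
      (ENNReal.ofReal_le_ofReal (le_of_eq ?_))
    rw [hκ, hδ]
    field_simp
    ring
  have hsum : γ ({w | ∃ p, s ≤ |w p|} ∪ ({w | |minorCoeff v₁ v₂ w k| < κ} ∪
      {w | κ ≤ |minorCoeff v₁ v₂ w k| ∧ |∑ j, w (j, 0) * minorCoeff v₁ v₂ w j| < δ}))
      ≤ ENNReal.ofReal (1 / (d : ℝ) ^ q) := by
    calc _ ≤ ENNReal.ofReal (1 / (2 * (d : ℝ) ^ q)) + (ENNReal.ofReal (1 / (4 * (d : ℝ) ^ q)) +
          ENNReal.ofReal (1 / (4 * (d : ℝ) ^ q))) :=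
          (measure_union_le _ _).trans (add_le_add e1
            ((measure_union_le _ _).trans (add_le_add e2 e3)))
      _ = _ := by
          rw [← ENNReal.ofReal_add (by positivity) (by positivity),
            ← ENNReal.ofReal_add (by positivity) (by positivity)]
          congr 1
          field_simp
          norm_num
  -- The measurable hull has the same measure and still contains every bad block.
  refine ⟨toMeasurable γ _, measurableSet_toMeasurable _ _,
    (measure_toMeasurable _).le.trans hsum, fun w hw => ?_⟩
  have hw := mt (fun h => subset_toMeasurable _ _ h) hw
  simp only [Set.mem_union, Set.mem_ofPred_eq, not_or, not_exists, not_le, not_lt, not_and] at hw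
  obtain ⟨h1, h2, h3⟩ := hw
  have := isGoodBlock_of_minor hd hV hs0 hδ0.le (fun p => (h1 p).le) (h3 h2)
  rw [hs2] at this
  convert this using 1
  · rw [blockBound]; ring
  · rw [blockCond]; congr 1; ring

theorem blockCond_pos {d : ℕ} (hd : 2 ≤ d) (q : ℕ) : 0 < blockCond d q := by
  have hd0 : (0 : ℝ) < d := by
    have : 0 < d := by omega
    exact_mod_cast this
  unfold blockCond
  positivity

/-- The prefactor is 2 ^ 21 d ^ (6q + 7), at most d ^ (6q + 28) because d ≥ 2. The power contributes
at most d ^ (-(6q + 28)); the factor 2 in the hypothesis offsets the halved rate 1/(2α). -/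
theorem power_large_enough {d q t : ℕ} {α : ℝ} (hd : 2 ≤ d) (hα : 100 < α)
    (ht : (2 * (6 * q + 28) : ℕ) * α * Real.log d ≤ t) :
    α ≤ t ∧ 4 * d * (blockBound d q / blockCond d q) * (1 - α⁻¹ / 2) ^ t ≤ 1 := by
  have hd2 : (2 : ℝ) ≤ d := by exact_mod_cast hd
  have hd0 : (0 : ℝ) < d := by linarith
  have hα0 : 0 < α := by linarith
  have hlog : 1 / 2 ≤ Real.log d := by
    have h1 : Real.log 2 ≤ Real.log d := Real.log_le_log (by norm_num) hd2
    have := Real.log_two_gt_d9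
    linarith
  have hq : (2 : ℝ) ≤ (2 * (6 * q + 28) : ℕ) := by exact_mod_cast (by omega)
  constructor
  · have h1 : 2 * α * (1 / 2) ≤ (2 * (6 * q + 28) : ℕ) * α * Real.log d := by gcongr
    linarith
  have hεpos : 0 < α⁻¹ := inv_pos.2 hα0
  have hε1 : α⁻¹ ≤ 1 := inv_le_one_of_one_le₀ (by linarith)
  have hη : (1 - α⁻¹ / 2) ^ t ≤ ((d : ℝ) ^ (6 * q + 28))⁻¹ := by
    calc (1 - α⁻¹ / 2) ^ t ≤ Real.exp (-(α⁻¹ / 2)) ^ t := by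
          refine pow_le_pow_left₀ (by linarith) ?_ t
          have := Real.add_one_le_exp (-(α⁻¹ / 2))
          linarith
      _ = Real.exp (-(t * α⁻¹ / 2)) := by rw [← Real.exp_nat_mul]; congr 1; ring
      _ ≤ Real.exp (-((6 * q + 28 : ℕ) * Real.log d)) := by
          refine Real.exp_le_exp.2 (neg_le_neg ?_)
          have h1 := mul_le_mul_of_nonneg_right ht hεpos.le
          have h2 : (2 * (6 * q + 28) : ℕ) * α * Real.log d * α⁻¹
              = 2 * ((6 * q + 28 : ℕ) * Real.log d) := by
            push_cast
            field_simp
          rw [h2] at h1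
          linarith
      _ = _ := by rw [Real.exp_neg, Real.exp_nat_mul, Real.exp_log hd0]
  have hR : blockBound d q / blockCond d q = 2 ^ 19 * (d : ℝ) ^ (6 * q + 6) := by
    rw [blockBound, blockCond]
    field_simp
    ring
  rw [hR]
  have h21 : (2 : ℝ) ^ 21 ≤ (d : ℝ) ^ 21 := pow_le_pow_left₀ (by norm_num) hd2 21
  calc 4 * d * (2 ^ 19 * (d : ℝ) ^ (6 * q + 6)) * (1 - α⁻¹ / 2) ^ t
      ≤ 4 * d * (2 ^ 19 * (d : ℝ) ^ (6 * q + 6)) * ((d : ℝ) ^ (6 * q + 28))⁻¹ := by gcongr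
    _ = 2 ^ 21 * (d : ℝ) ^ (6 * q + 7) * ((d : ℝ) ^ (6 * q + 28))⁻¹ := by ring
    _ ≤ (d : ℝ) ^ 21 * (d : ℝ) ^ (6 * q + 7) * ((d : ℝ) ^ (6 * q + 28))⁻¹ := by gcongr
    _ = 1 := by
        rw [← pow_add, show 21 + (6 * q + 7) = 6 * q + 28 by ring]
        exact mul_inv_cancel₀ (by positivity)

end

end ShiftEstimate

/-! ### Union bound over the start blocks. -/

theorem mainTheorem9 (q : ℕ) :
    ∃ c : ℝ, 0 < c ∧
      ∀ (n d : ℕ) (hd : 2 ≤ d) (A : Matrix (Fin n) (Fin d) ℝ), 0 < ShiftEstimate.gap hd A →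
      ∀ (α : ℝ), 100 < α →
      -- for arbitrary power `t` and arbitrary start blocks: accurate calls give the outcome
      (∀ (t : ℕ) (W : ℕ → Matrix (Fin d) (Fin 2) ℝ),
        ShiftEstimate.CallsAccurate hd A α t W → ShiftEstimate.Succeeds hd A t W) ∧
      -- for Gaussian start blocks and `t ≥ c α log d`: failure has small probability
      (∀ (t : ℕ), c * α * Real.log d ≤ t →
        ∀ (Ω : Type*) [MeasurableSpace Ω] (P : MeasureTheory.Measure Ω)
          [MeasureTheory.IsProbabilityMeasure P]
          (W : Ω → ℕ → Matrix (Fin d) (Fin 2) ℝ),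
          ProbabilityTheory.iIndepFun
            (fun (p : ℕ × Fin d × Fin 2) (ω : Ω) => W ω p.1 p.2.1 p.2.2) P →
          (∀ (i : ℕ) (a : Fin d) (b : Fin 2),
            ProbabilityTheory.HasLaw (fun ω => W ω i a b) (ProbabilityTheory.gaussianReal 0 1) P) →
          P {ω | ¬ (ShiftEstimate.CallsAccurate hd A α t (W ω) ∧
              ShiftEstimate.Succeeds hd A t (W ω))} ≤
            ENNReal.ofReal (((ShiftEstimate.maxIter hd A : ℝ) + 1) / (d : ℝ) ^ q)) := by
  refine ⟨(2 * (6 * q + 28) : ℕ), by positivity, fun n d hd A hgap α hα =>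
    ⟨fun t W h => h.succeeds hgap hα, ?_⟩⟩
  intro t ht Ω _ P _ W hind hlaw
  obtain ⟨htα, hη⟩ := ShiftEstimate.power_large_enough hd hα ht
  have ht1 : 1 ≤ t := by
    have : (1 : ℝ) ≤ t := by linarith
    exact_mod_cast this
  have hdiag := ShiftEstimate.isSortedDiag_gram A
  obtain ⟨S, hS, hSle, hgood⟩ :=
    ShiftEstimate.exists_measurableSet_not_isGoodBlock hd q hdiag.orth
  have hblock : ∀ i, P {ω | (fun p : Fin d × Fin 2 => W ω i p.1 p.2) ∈ S}
      ≤ ENNReal.ofReal (1 / (d : ℝ) ^ q) := by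
    intro i
    have hinj : Function.Injective (fun p : Fin d × Fin 2 => (i, p)) := fun p p' h => by
      simpa using h
    have hm : ∀ p : Fin d × Fin 2, AEMeasurable (fun ω => W ω i p.1 p.2) P :=
      fun p => (hlaw i p.1 p.2).aemeasurable
    have hmap := (hind.precomp hinj).map_fun_eq_pi_map hm
    simp only [(hlaw i _ _).map_eq] at hmap
    refine le_trans (le_of_eq ?_) hSle
    rw [← hmap, MeasureTheory.Measure.map_apply_of_aemeasurable (aemeasurable_pi_lambda _ hm) hS]
    rfl
  set N := ShiftEstimate.maxIter hd A with hN
  -- A single set S, fixed by the eigenbasis of AᵀA, serves all blocks: outside these events every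
  -- call up to N is accurate, whatever shifts arise.
  have hsub : {ω | ¬ (ShiftEstimate.CallsAccurate hd A α t (W ω) ∧
      ShiftEstimate.Succeeds hd A t (W ω))} ⊆
      ⋃ i ∈ Finset.range (N + 1), {ω | (fun p : Fin d × Fin 2 => W ω i p.1 p.2) ∈ S} := by
    intro ω hω
    by_contra hno
    simp only [Set.mem_iUnion, not_exists, Finset.mem_range] at hno
    have hacc := ShiftEstimate.callAccurate_of_isGoodBlock (W := W ω) hgap hα
      (ShiftEstimate.blockCond_pos hd q) ht1 htα hη N
      fun i hi => hgood _ (hno i (by omega))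
    have hcalls : ShiftEstimate.CallsAccurate hd A α t (W ω) := fun i hi _ => hacc i hi
    exact hω ⟨hcalls, hcalls.succeeds hgap hα⟩
  calc _ ≤ ∑ i ∈ Finset.range (N + 1),
        P {ω | (fun p : Fin d × Fin 2 => W ω i p.1 p.2) ∈ S} :=
        (MeasureTheory.measure_mono hsub).trans (MeasureTheory.measure_biUnion_finset_le _ _)
    _ ≤ ∑ _i ∈ Finset.range (N + 1), ENNReal.ofReal (1 / (d : ℝ) ^ q) :=
        Finset.sum_le_sum fun i _ => hblock i
    _ = _ := by
        rw [Finset.sum_const, Finset.card_range, nsmul_eq_mul, ← ENNReal.ofReal_natCast,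
          ← ENNReal.ofReal_mul (by positivity), mul_one_div]
        push_cast
        rfl
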